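/- Let $m \ge 3$ and let $\Delta$ be a thick compact $m$-gon: $\Delta$ is a spherical building of rank $2$ and diameter $m$ (a one-dimensional simplicial complex which is a building whose apartments are circuits of length $2m$), every vertex of $\Delta$ lies in at least three chambers, and the vertex set $\mathrm{Vert}\,\Delta$ carries a compact Hausdorff topology such that the set $\mathrm{Ch}\,\Delta$ of chambers (edges), each viewed as the pair of its vertices ordered by type, is closed in $(\mathrm{Vert}\,\Delta)^2$. Let $\mathrm{Aut}_{\mathrm{top}}(\Delta)$ be the group of all automorphisms of the simplicial complex $\Delta$ which act on $\mathrm{Vert}\,\Delta$ and on $\mathrm{Ch}\,\Delta$ (with the topology induced from $(\mathrm{Vert}\,\Delta)^2$) as homeomorphisms, equipped with the topology induced from the compact-open topology of $C(\mathrm{Ch}\,\Delta, \mathrm{Ch}\,\Delta)$. Then $\mathrm{Aut}_{\mathrm{top}}(\Delta)$ is a locally compact group, i.e. a locally compact Hausdorff topological group. -/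

import Mathlib

namespace CompactPolygon

variable {V : Type*}

/-- The simplices of a one-dimensional simplicial complex, given as a subcomplex `A` of the
one-dimensional complex (graph) `G`: the empty simplex, the vertices and the edges of `A`,
each viewed as its set of vertices. -/
def IsSimplex {G : SimpleGraph V} (A : G.Subgraph) (σ : Set V) : Prop :=
  σ = ∅ ∨ (∃ v ∈ A.verts, σ = {v}) ∨ ∃ u v, A.Adj u v ∧ σ = {u, v}

/-- `𝒜` is a system of apartments making the one-dimensional simplicial complex `G` a building
of rank two whose apartments are Coxeter complexes of the dihedral group of order `2 * m`, that is,
circuits of length `2 * m`. -/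
structure IsApartmentSystem (G : SimpleGraph V) (m : ℕ) (𝒜 : Set G.Subgraph) : Prop where
  /-- Every apartment is a Coxeter complex, the `2m`-circuit. -/
  coxeter : ∀ A ∈ 𝒜, Nonempty (A.coe ≃g SimpleGraph.cycleGraph (2 * m))
  /-- Any two simplices lie in a common apartment. -/
  exists_common : ∀ σ σ' : Set V, IsSimplex (⊤ : G.Subgraph) σ → IsSimplex (⊤ : G.Subgraph) σ' →
    ∃ A ∈ 𝒜, IsSimplex A σ ∧ IsSimplex A σ'
  /-- If two apartments contain two simplices `σ` and `σ'`, there is an isomorphism between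
  the apartments which fixes `σ` and `σ'` pointwise. -/
  exists_iso : ∀ A ∈ 𝒜, ∀ A' ∈ 𝒜, ∀ σ σ' : Set V,
    IsSimplex A σ → IsSimplex A σ' → IsSimplex A' σ → IsSimplex A' σ' →
    ∃ f : A.coe ≃g A'.coe, ∀ v : A.verts, (v : V) ∈ σ ∪ σ' → (f v : V) = v

/-- The one-dimensional simplicial complex `G` is an `m`-gon (for `2 ≤ m`): a spherical building of
rank two and diameter `m`. -/
def IsPolygon (G : SimpleGraph V) (m : ℕ) : Prop :=
  ∃ 𝒜 : Set G.Subgraph, IsApartmentSystem G m 𝒜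

/-- Every panel (which in rank two is a vertex) lies in at least three chambers (edges). -/
def IsThick (G : SimpleGraph V) : Prop :=
  ∀ v : V, 3 ≤ (G.neighborSet v).encard

/-- The set of chambers of `G`, each written as the pair of its vertices, ordered by their type
(`τ` is the type function, whose values `0` and `1` come in this order). -/
def chambers (G : SimpleGraph V) (τ : G.Coloring (Fin 2)) : Set (V × V) :=
  {c | G.Adj c.1 c.2 ∧ τ c.1 = 0 ∧ τ c.2 = 1}

/-- The topological space of chambers, with the topology induced from `V × V`. -/
abbrev Cham (G : SimpleGraph V) (τ : G.Coloring (Fin 2)) : Type _ :=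
  chambers G τ

variable {G : SimpleGraph V} {τ : G.Coloring (Fin 2)}

theorem type_cases {a b : V} (h : G.Adj a b) :
    (τ a = 0 ∧ τ b = 1) ∨ (τ a = 1 ∧ τ b = 0) := by
  have h1 : τ a ≠ τ b := τ.valid h
  generalize τ a = x at *
  generalize τ b = y at *
  fin_cases x <;> fin_cases y <;> simp_all

/-- The action of an automorphism `φ` (which need not preserve types) on chambers: the chamber with
vertices `a` and `b` goes to the one with vertices `φ a` and `φ b`. -/
def chamMap (τ : G.Coloring (Fin 2)) (φ : G ≃g G) (c : Cham G τ) : Cham G τ :=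
  if h : τ (φ c.1.1) = 0 then
    ⟨(φ c.1.1, φ c.1.2), by
      have hadj : G.Adj (φ c.1.1) (φ c.1.2) := φ.map_adj_iff.2 c.2.1
      rcases type_cases (τ := τ) hadj with h' | h'
      · exact ⟨hadj, h'⟩
      · exact absurd (h.symm.trans h'.1) (by decide)⟩
  else
    ⟨(φ c.1.2, φ c.1.1), by
      have hadj : G.Adj (φ c.1.1) (φ c.1.2) := φ.map_adj_iff.2 c.2.1
      rcases type_cases (τ := τ) hadj with h' | h'
      · exact absurd h'.1 h
      · exact ⟨hadj.symm, h'.2, h'.1⟩⟩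

theorem chamMap_spec (φ : G ≃g G) (c : Cham G τ) :
    (chamMap τ φ c).1 = (φ c.1.1, φ c.1.2) ∨ (chamMap τ φ c).1 = (φ c.1.2, φ c.1.1) := by
  unfold chamMap
  split_ifs
  · exact Or.inl rfl
  · exact Or.inr rfl

/-- A chamber is determined by its set of vertices. -/
theorem cham_ext {c d : Cham G τ}
    (h : c.1 = d.1 ∨ c.1 = (d.1.2, d.1.1)) : c = d := by
  rcases h with h | h
  · exact Subtype.ext h
  · exfalso
    have h1 : τ c.1.1 = 0 := c.2.2.1
    have h2 : τ d.1.2 = 1 := d.2.2.2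
    rw [h] at h1
    exact absurd (h1.symm.trans h2) (by decide)

theorem chamMap_one : chamMap τ (1 : G ≃g G) = id := by
  funext c
  apply cham_ext
  rcases chamMap_spec (τ := τ) (1 : G ≃g G) c with h | h <;> rw [h]
  · exact Or.inl rfl
  · exact Or.inr rfl

theorem chamMap_mul (φ ψ : G ≃g G) :
    chamMap τ (φ * ψ) = chamMap τ φ ∘ chamMap τ ψ := by
  funext c
  apply cham_ext
  simp only [Function.comp_apply]
  rcases chamMap_spec (τ := τ) (φ * ψ) c with h | h <;>
  rcases chamMap_spec (τ := τ) ψ c with h' | h' <;>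
  rcases chamMap_spec (τ := τ) φ (chamMap τ ψ c) with h'' | h'' <;>
  rw [h, h'', h'] <;> simp [RelIso.mul_apply]

variable [TopologicalSpace V]

variable (G τ) in
/-- The group of topological automorphisms: all automorphisms of the simplicial complex `G`
(not necessarily preserving types) whose actions on the vertices and on the chambers are
homeomorphisms. -/
def AutTop : Subgroup (G ≃g G) where
  carrier := {φ | IsHomeomorph (φ : V → V) ∧ IsHomeomorph (chamMap τ φ)}
  one_mem' := by
    refine ⟨(Homeomorph.refl V).isHomeomorph, ?_⟩
    rw [chamMap_one]
    exact (Homeomorph.refl _).isHomeomorph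
  mul_mem' := by
    rintro φ ψ ⟨h1, h2⟩ ⟨h3, h4⟩
    refine ⟨h1.comp h3, ?_⟩
    rw [chamMap_mul]
    exact h2.comp h4
  inv_mem' := by
    rintro φ ⟨h1, h2⟩
    constructor
    · have h : ((φ⁻¹ : G ≃g G) : V → V) = (h1.homeomorph _).symm := by
        funext v
        apply h1.injective
        refine Eq.trans ?_ ((h1.homeomorph _).apply_symm_apply v).symm
        exact φ.apply_symm_apply v
      rw [h]
      exact Homeomorph.isHomeomorph _
    · have h : chamMap τ φ⁻¹ = (h2.homeomorph _).symm := by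
        funext c
        apply h2.injective
        refine Eq.trans ?_ ((h2.homeomorph _).apply_symm_apply c).symm
        have := congrFun (chamMap_mul (τ := τ) φ φ⁻¹) c
        rw [mul_inv_cancel, chamMap_one] at this
        exact this.symm
      rw [h]
      exact Homeomorph.isHomeomorph _

/-- The continuous map from the chamber space to itself given by a topological automorphism. -/
def AutTop.toContinuousMap (φ : AutTop G τ) : C(Cham G τ, Cham G τ) :=
  ⟨chamMap τ φ.1, φ.2.2.continuous⟩

/-- The topology on `AutTop G τ` is induced by the compact-open topology of
`C(Cham G τ, Cham G τ)`. -/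
instance : TopologicalSpace (AutTop G τ) :=
  TopologicalSpace.induced AutTop.toContinuousMap inferInstance

end CompactPolygon

/-! Write m = n + 3 and call the set D(v) of neighbours of v its row. The argument is of
Arzelà–Ascoli type: it suffices to find an entourage `W` such that the automorphisms `W`-close to
the identity are equicontinuous (`exists_entourage_equicontinuous`). Ultralimits of such
automorphisms and of their inverses are then mutually inverse continuous automorphisms, so these
maps form a compact neighbourhood of 1 (`isCompact_setOf_apply_mem`, `setOf_apply_mem_nhds_one`),
and a topological group with such a neighbourhood is locally compact.

The heart is equicontinuity on one row D(l) at a point o (`ulimMap_eq_of_nonisolated`). Let F be the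
pointwise limit of automorphisms Φ i near the identity, and suppose e i → o in D(l) but Φ i (e i)
does not tend to F o. Choose c opposite l and let l' be the neighbour of o nearest to c. For c' near
c and opposite both l and l', the projectivity D(l) → D(c') → D(l') fixes o. As c' → c it
degenerates, sending everything except o to a single point p. Transported by Φ, its values therefore
end in disjoint closed neighbourhoods P₀ of o and P₁ of p. If the transported projectivities also
degenerate, the family e produces a point of both P₀ and P₁. Otherwise their limit maps onto D(F
l'), and by thickness it reaches a neighbour outside P₀ ∪ P₁. Both are impossible.

Such c' ≠ c exist because non-isolation of o in D(l) carries over to c in a row D(q)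
(`exists_ultrafilter_of_nonisolated`); at isolated o there is nothing to prove. Compactness makes
`W` uniform, and projections between rows spread equicontinuity to all vertices. -/

namespace CompactPolygon

/-- `Reach G k x y` says that there is a walk of length `k` from `x` to `y`. -/
def Reach {V : Type*} (G : SimpleGraph V) : ℕ → V → V → Prop
  | 0, x, y => x = y
  | k + 1, x, y => ∃ z, G.Adj x z ∧ Reach G k z y

/-! ### Walks of given length, and parity. -/

section Reach

variable {V : Type*} {G : SimpleGraph V}

theorem Reach.cons {k : ℕ} {x y z : V} (h : G.Adj x y) (h' : Reach G k y z) :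
    Reach G (k + 1) x z := ⟨y, h, h'⟩

theorem Reach.trans {j k : ℕ} {x y z : V} (h : Reach G j x y) (h' : Reach G k y z) :
    Reach G (j + k) x z := by
  induction j generalizing x with
  | zero => cases h; simpa using h'
  | succ j ih =>
    obtain ⟨w, hw, h⟩ := h
    rw [Nat.add_right_comm]
    exact ⟨w, hw, ih h⟩

theorem Reach.concat {k : ℕ} {x y z : V} (h : Reach G k x y) (h' : G.Adj y z) :
    Reach G (k + 1) x z :=
  h.trans ⟨z, h', rfl⟩

theorem Reach.symm {k : ℕ} {x y : V} (h : Reach G k x y) : Reach G k y x := by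
  induction k generalizing x with
  | zero => exact Eq.symm h
  | succ k ih =>
    obtain ⟨w, hw, h⟩ := h
    exact (ih h).concat hw.symm

theorem Reach.map {k : ℕ} {x y : V} (φ : G ≃g G) (h : Reach G k x y) :
    Reach G k (φ x) (φ y) := by
  induction k generalizing x with
  | zero => exact congrArg φ h
  | succ k ih =>
    obtain ⟨w, hw, h⟩ := h
    exact ⟨φ w, φ.map_adj_iff.2 hw, ih h⟩

/-- Backtracking along an edge pads a walk. Together with parity this makes `Reach G k` mean
"distance at most k and congruent to k mod 2", so distances can be handled through walks alone. -/
theorem Reach.add_two {k : ℕ} {x y : V} (h : Reach G k x y) (hx : ∃ z, G.Adj x z) :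
    Reach G (k + 2) x y := by
  obtain ⟨z, hz⟩ := hx
  exact ⟨z, hz, x, hz.symm, h⟩

theorem Reach.add_even {k : ℕ} {x y : V} (h : Reach G k x y) (hx : ∃ z, G.Adj x z) (j : ℕ) :
    Reach G (k + 2 * j) x y := by
  induction j with
  | zero => exact h
  | succ j ih => exact ih.add_two hx

theorem Reach.color {k : ℕ} {x y : V} (τ : G.Coloring (Fin 2)) (h : Reach G k x y) :
    ((τ y : Fin 2) : ℕ) % 2 = ((τ x : Fin 2) + k) % 2 := by
  induction k generalizing x with
  | zero => rw [show x = y from h, Nat.add_zero]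
  | succ k ih =>
    obtain ⟨w, hw, h⟩ := h
    have h1 := ih h
    rcases type_cases (τ := τ) hw with ⟨h2, h3⟩ | ⟨h2, h3⟩ <;> rw [h2] <;> rw [h3] at h1 <;>
      simp at h1 ⊢ <;> omega

theorem Reach.parity {j k : ℕ} {x y : V} (τ : G.Coloring (Fin 2)) (h : Reach G j x y)
    (h' : Reach G k x y) : j % 2 = k % 2 := by
  have h1 := h.color τ
  have h2 := h'.color τ
  omega

end Reach

/-- The combinatorial properties of a thick generalized `(n + 3)`-gon which are used here. -/
structure IsGenPolygon {V : Type*} (G : SimpleGraph V) (n : ℕ) : Prop where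
  parity : ∀ {j k : ℕ} {x y : V}, Reach G j x y → Reach G k x y → j % 2 = k % 2
  diam : ∀ x y : V, Reach G (n + 3) x y ∨ Reach G (n + 2) x y
  uniq : ∀ {a b z z' : V}, G.Adj a z → G.Adj a z' → Reach G (n + 1) z b → Reach G (n + 1) z' b →
    ¬ Reach G n a b → z = z'
  exists_opp : ∀ a : V, ∃ b, ¬ Reach G (n + 2) a b ∧ ¬ Reach G (n + 1) a b
  thick : ∀ v a b : V, ∃ c, G.Adj v c ∧ c ≠ a ∧ c ≠ b

/-! ### From apartments to the metric properties of a generalized polygon. -/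

section Apartments

variable {V : Type*} {G : SimpleGraph V}

/-- `θ` identifies the apartment `A` with the circuit on `ZMod N`, sending the chamber `{a, z}`
to `{0, 1}`. -/
structure IsCoord (A : G.Subgraph) (a z : V) {N : ℕ} (θ : V → ZMod N) : Prop where
  inj : Set.InjOn θ A.verts
  surj : ∀ i, ∃ v ∈ A.verts, θ v = i
  adj : ∀ u ∈ A.verts, ∀ v ∈ A.verts, A.Adj u v ↔ θ u - θ v = 1 ∨ θ v - θ u = 1
  zero : θ a = 0
  one : θ z = 1

theorem IsSimplex.mem_verts {A : G.Subgraph} {v : V} (h : IsSimplex A {v}) : v ∈ A.verts := by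
  rcases h with h | ⟨w, hw, h⟩ | ⟨u, w, hw, h⟩
  · exact absurd h (Set.singleton_ne_empty v)
  · rwa [Set.singleton_eq_singleton_iff.1 h]
  · have : u ∈ ({v} : Set V) := h ▸ Set.mem_insert u {w}
    rw [← Set.mem_singleton_iff.1 this]
    exact hw.fst_mem

theorem IsSimplex.adj {A : G.Subgraph} {v w : V} (hvw : G.Adj v w) (h : IsSimplex A {v, w}) :
    A.Adj v w := by
  rcases h with h | ⟨x, hx, h⟩ | ⟨x, y, hxy, h⟩
  · exact absurd h (Set.insert_nonempty v {w}).ne_empty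
  · have h1 : v ∈ ({x} : Set V) := h ▸ Set.mem_insert v {w}
    have h2 : w ∈ ({x} : Set V) := h ▸ Set.mem_insert_of_mem v rfl
    exact absurd (h1.trans h2.symm) hvw.ne
  · rcases (Set.pair_eq_pair_iff.1 h) with ⟨rfl, rfl⟩ | ⟨rfl, rfl⟩
    · exact hxy
    · exact hxy.symm

theorem isSimplex_singleton {A : G.Subgraph} {v : V} (h : v ∈ A.verts) : IsSimplex A {v} :=
  Or.inr (Or.inl ⟨v, h, rfl⟩)

theorem isSimplex_pair {A : G.Subgraph} {v w : V} (h : A.Adj v w) : IsSimplex A {v, w} :=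
  Or.inr (Or.inr ⟨v, w, h, rfl⟩)

variable {n : ℕ} {𝒜 : Set G.Subgraph}

theorem IsApartmentSystem.exists_coord (h𝒜 : IsApartmentSystem G (n + 3) 𝒜) {A : G.Subgraph}
    (hA : A ∈ 𝒜) {a z : V} (haz : A.Adj a z) :
    ∃ θ : V → ZMod (2 * n + 4 + 2), IsCoord A a z θ := by
  classical
  obtain ⟨f⟩ := h𝒜.coxeter A hA
  rw [show 2 * (n + 3) = 2 * n + 4 + 2 by ring] at f
  let θ₀ : V → ZMod (2 * n + 4 + 2) := fun v => if h : v ∈ A.verts then f ⟨v, h⟩ else 0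
  have hθ : ∀ v (h : v ∈ A.verts), θ₀ v = f ⟨v, h⟩ := fun v h => dif_pos h
  have hinj : Set.InjOn θ₀ A.verts := fun u hu v hv huv => by
    rw [hθ u hu, hθ v hv] at huv
    exact congrArg Subtype.val (f.injective huv)
  have hsurj : ∀ i, ∃ v ∈ A.verts, θ₀ v = i := fun i => by
    obtain ⟨v, hv⟩ := f.surjective i
    exact ⟨v.1, v.2, (hθ v.1 v.2).trans hv⟩
  have hadj : ∀ u ∈ A.verts, ∀ v ∈ A.verts,
      A.Adj u v ↔ θ₀ u - θ₀ v = 1 ∨ θ₀ v - θ₀ u = 1 := fun u hu v hv => by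
    rw [hθ u hu, hθ v hv]
    have h := f.map_adj_iff (v := ⟨u, hu⟩) (w := ⟨v, hv⟩)
    rw [SimpleGraph.Subgraph.coe_adj] at h
    exact h.symm
  -- A reflection or a translation of the circuit moves (a, z) to (0, 1), according to the
  -- orientation.
  rcases (hadj a haz.fst_mem z haz.snd_mem).1 haz with h | h
  · refine ⟨fun v => θ₀ a - θ₀ v, fun u hu v hv huv => hinj hu hv (sub_right_injective huv),
      fun i => ?_, fun u hu v hv => ?_, sub_self _, h⟩
    · obtain ⟨v, hv, h⟩ := hsurj (θ₀ a - i)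
      exact ⟨v, hv, by simp [h]⟩
    · rw [hadj u hu v hv, sub_sub_sub_cancel_left, sub_sub_sub_cancel_left, or_comm]
  · refine ⟨fun v => θ₀ v - θ₀ a, fun u hu v hv huv => hinj hu hv (sub_left_injective huv),
      fun i => ?_, fun u hu v hv => ?_, sub_self _, h⟩
    · obtain ⟨v, hv, h⟩ := hsurj (i + θ₀ a)
      exact ⟨v, hv, by simp [h]⟩
    · rw [hadj u hu v hv, sub_sub_sub_cancel_right, sub_sub_sub_cancel_right]

theorem zmod_two_ne_zero : (2 : ZMod (2 * n + 4 + 2)) ≠ 0 := by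
  intro h
  have h' : ((2 : ℕ) : ZMod (2 * n + 4 + 2)) = 0 := by exact_mod_cast h
  rw [ZMod.natCast_eq_zero_iff] at h'
  have := Nat.le_of_dvd (by norm_num) h'
  omega

/-- An injective walk on the circuit cannot turn back, since it would revisit the point two steps
earlier; its first step decides the rest. -/
theorem circuit_rigid {η : ZMod (2 * n + 4 + 2) → ZMod (2 * n + 4 + 2)}
    (hinj : Function.Injective η) (hadj : ∀ i, η (i + 1) - η i = 1 ∨ η i - η (i + 1) = 1)
    (h0 : η 0 = 0) (h1 : η 1 = 1) : η = id := by
  have key : ∀ k : ℕ, η (k : ZMod (2 * n + 4 + 2)) = k ∧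
      η ((k : ZMod (2 * n + 4 + 2)) + 1) = k + 1 := by
    intro k
    induction k with
    | zero => simp [h0, h1]
    | succ k ih =>
      refine ⟨by push_cast; exact ih.2, ?_⟩
      push_cast
      rcases hadj ((k : ZMod (2 * n + 4 + 2)) + 1) with h | h
      · rw [ih.2] at h
        linear_combination h
      · rw [ih.2] at h
        have h2 : η ((k : ZMod (2 * n + 4 + 2)) + 1 + 1) = η k := by
          rw [ih.1]
          linear_combination -h
        have h3 := hinj h2
        exact absurd (by linear_combination h3) (zmod_two_ne_zero (n := n))
  funext i
  have := (key i.val).1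
  rwa [ZMod.natCast_zmod_val] at this

/-- The building axiom gives an isomorphism of the apartments fixing a, z and v; read in coordinates
it is the identity by rigidity. This makes the retraction well defined. -/
theorem IsApartmentSystem.coord_eq (h𝒜 : IsApartmentSystem G (n + 3) 𝒜) {A B : G.Subgraph}
    (hA : A ∈ 𝒜) (hB : B ∈ 𝒜) {a z : V} (hAaz : A.Adj a z) (hBaz : B.Adj a z)
    {θ θ' : V → ZMod (2 * n + 4 + 2)} (hθ : IsCoord A a z θ) (hθ' : IsCoord B a z θ') {v : V}
    (hAv : v ∈ A.verts) (hBv : v ∈ B.verts) : θ v = θ' v := by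
  obtain ⟨g, hg⟩ := h𝒜.exists_iso A hA B hB {a, z} {v} (isSimplex_pair hAaz)
    (isSimplex_singleton hAv) (isSimplex_pair hBaz) (isSimplex_singleton hBv)
  choose s hs hθs using hθ.surj
  have hsθ : ∀ u ∈ A.verts, s (θ u) = u := fun u hu => hθ.inj (hs _) hu (hθs _)
  have hgv : ∀ u (hu : u ∈ A.verts), u ∈ ({a, z} ∪ {v} : Set V) → (g ⟨s (θ u), hs _⟩ : V) = u :=
    fun u hu h => by
      have := hg ⟨u, hu⟩ h
      simpa only [hsθ u hu] using this
  have hη : (fun i => θ' (g ⟨s i, hs i⟩)) = id := by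
    refine circuit_rigid ?_ ?_ ?_ ?_
    · intro i j hij
      have h1 := g.injective (Subtype.ext (hθ'.inj (g ⟨s i, hs i⟩).2 (g ⟨s j, hs j⟩).2 hij))
      have h2 : s i = s j := congrArg Subtype.val h1
      rw [← hθs i, ← hθs j, h2]
    · intro i
      have h1 : A.Adj (s (i + 1)) (s i) :=
        (hθ.adj _ (hs _) _ (hs _)).2 (Or.inl (by rw [hθs, hθs]; ring))
      have h2 : A.coe.Adj ⟨s (i + 1), hs _⟩ ⟨s i, hs _⟩ := h1
      have h3 := g.map_adj_iff.2 h2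
      exact (hθ'.adj _ (g _).2 _ (g _).2).1 h3
    · have := hgv a hAaz.fst_mem (by simp)
      simp only [hθ.zero] at this
      simp only [this, hθ'.zero]
    · have := hgv z hAaz.snd_mem (by simp)
      simp only [hθ.one] at this
      simp only [this, hθ'.one]
  have h1 := congrFun hη (θ v)
  simp only [id, hgv v hAv (by simp)] at h1
  exact h1.symm

/-- The retraction of a polygon onto a circuit, centred at the chamber `{a, z}`. -/
theorem IsApartmentSystem.exists_retraction (h𝒜 : IsApartmentSystem G (n + 3) 𝒜) {a z : V}
    (haz : G.Adj a z) :
    ∃ h : V → ZMod (2 * n + 4 + 2), (∀ u v, G.Adj u v → h u - h v = 1 ∨ h v - h u = 1) ∧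
      ∀ A ∈ 𝒜, A.Adj a z → IsCoord A a z h := by
  have h0 : IsSimplex (⊤ : G.Subgraph) {a, z} := isSimplex_pair haz
  have hex : ∀ v, ∃ A ∈ 𝒜, A.Adj a z ∧ v ∈ A.verts := fun v => by
    obtain ⟨A, hA, h1, h2⟩ := h𝒜.exists_common {a, z} {v} h0 (isSimplex_singleton trivial)
    exact ⟨A, hA, h1.adj haz, h2.mem_verts⟩
  choose B hB hBaz hBv using hex
  have hc : ∀ v, ∃ θ : V → ZMod (2 * n + 4 + 2), IsCoord (B v) a z θ :=
    fun v => h𝒜.exists_coord (hB v) (hBaz v)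
  choose θ hθ using hc
  have key : ∀ A ∈ 𝒜, A.Adj a z → IsCoord A a z (fun v => θ v v) := by
    intro A hA hAaz
    obtain ⟨θ', hθ'⟩ := h𝒜.exists_coord hA hAaz
    have heq : ∀ v ∈ A.verts, θ v v = θ' v := fun v hv =>
      h𝒜.coord_eq (hB v) hA (hBaz v) hAaz (hθ v) hθ' (hBv v) hv
    refine ⟨fun u hu v hv huv => hθ'.inj hu hv ?_, fun i => ?_, fun u hu v hv => ?_, ?_, ?_⟩
    · rw [← heq u hu, ← heq v hv]; exact huv
    · obtain ⟨v, hv, h⟩ := hθ'.surj i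
      exact ⟨v, hv, (heq v hv).trans h⟩
    · simp only [heq u hu, heq v hv]; exact hθ'.adj u hu v hv
    · exact (hθ a).zero
    · exact (hθ z).one
  refine ⟨fun v => θ v v, fun u v huv => ?_, key⟩
  obtain ⟨A, hA, h1, h2⟩ := h𝒜.exists_common {a, z} {u, v} h0 (isSimplex_pair huv)
  have h2 := h2.adj huv
  exact ((key A hA (h1.adj haz)).adj u h2.fst_mem v h2.snd_mem).1 h2

/-- Along a walk the retraction moves by ±1 at each step; summing the steps in ℤ keeps both the
length bound and the parity. -/
theorem Reach.exists_int {N k : ℕ} {h : V → ZMod N}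
    (hh : ∀ u v, G.Adj u v → h u - h v = 1 ∨ h v - h u = 1) {x y : V} (hxy : Reach G k x y) :
    ∃ j : ℤ, |j| ≤ k ∧ (j - k) % 2 = 0 ∧ h y = h x + j := by
  induction k generalizing x with
  | zero => exact ⟨0, by simp, by simp, by rw [show x = y from hxy]; simp⟩
  | succ k ih =>
    obtain ⟨w, hw, hxy⟩ := hxy
    obtain ⟨j, hj, hj2, hj3⟩ := ih hxy
    rw [abs_le] at hj
    rcases hh _ _ hw with h1 | h1
    · refine ⟨j - 1, abs_le.2 (by push_cast; omega), by push_cast; omega, ?_⟩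
      push_cast; rw [hj3]; linear_combination -h1
    · refine ⟨j + 1, abs_le.2 (by push_cast; omega), by push_cast; omega, ?_⟩
      push_cast; rw [hj3]; linear_combination h1

theorem IsCoord.reach_natAbs {A : G.Subgraph} {a z : V} {N : ℕ} {θ : V → ZMod N}
    (hθ : IsCoord A a z θ) (k : ℕ) {x y : V} (hx : x ∈ A.verts) (hy : y ∈ A.verts)
    (h : θ y = θ x + k ∨ θ x = θ y + k) : Reach G k x y := by
  induction k generalizing x with
  | zero =>
    refine hθ.inj hx hy ?_
    rcases h with h | h <;> simp [h]
  | succ k ih =>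
    rcases h with h | h
    · obtain ⟨w, hw, hw'⟩ := hθ.surj (θ x + 1)
      refine ⟨w, A.adj_sub ((hθ.adj x hx w hw).2 (Or.inr (by rw [hw']; ring))), ih hw (Or.inl ?_)⟩
      rw [h, hw']; push_cast; ring
    · obtain ⟨w, hw, hw'⟩ := hθ.surj (θ x - 1)
      refine ⟨w, A.adj_sub ((hθ.adj x hx w hw).2 (Or.inl (by rw [hw']; ring))), ih hw (Or.inr ?_)⟩
      rw [hw', h]; push_cast; ring

theorem IsCoord.reach_int {A : G.Subgraph} {a z : V} {N : ℕ} {θ : V → ZMod N}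
    (hθ : IsCoord A a z θ) (j : ℤ) {x y : V} (hx : x ∈ A.verts) (hy : y ∈ A.verts)
    (h : θ y = θ x + j) : Reach G j.natAbs x y := by
  obtain ⟨k, rfl | rfl⟩ := j.eq_nat_or_neg
  · exact hθ.reach_natAbs _ hx hy (Or.inl (by simpa using h))
  · rw [Int.natAbs_neg, Int.natAbs_natCast]
    exact hθ.reach_natAbs _ hx hy (Or.inr (by rw [h]; push_cast; ring))

theorem IsThick.exists_adj (hthick : IsThick G) (v a b : V) : ∃ c, G.Adj v c ∧ c ≠ a ∧ c ≠ b := by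
  by_contra hcon
  push Not at hcon
  have h1 : G.neighborSet v ⊆ {a, b} := fun c hc => by
    by_cases h : c = a
    · exact Or.inl h
    · exact Or.inr (hcon c hc h)
  have h2 := (hthick v).trans (Set.encard_le_encard h1)
  have h3 := h2.trans ((Set.encard_insert_le {b} a).trans_eq (by rw [Set.encard_singleton]; rfl : _ = (2 : ℕ∞)))
  exact absurd h3 (by decide)

theorem IsPolygon.isGenPolygon (τ : G.Coloring (Fin 2)) (hG : IsPolygon G (n + 3))
    (hthick : IsThick G) : IsGenPolygon G n := by
  obtain ⟨𝒜, h𝒜⟩ := hG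
  have hnb : ∀ v, ∃ z, G.Adj v z := fun v =>
    (hthick.exists_adj v v v).imp fun _ h => h.1
  have hap : ∀ a z b, G.Adj a z → ∃ A ∈ 𝒜, A.Adj a z ∧ b ∈ A.verts := fun a z b haz => by
    obtain ⟨A, hA, h1, h2⟩ := h𝒜.exists_common {a, z} {b} (isSimplex_pair haz)
      (isSimplex_singleton trivial)
    exact ⟨A, hA, h1.adj haz, h2.mem_verts⟩
  have hcast : ∀ j : ℤ, (j : ZMod (2 * n + 4 + 2)) = 0 → ((2 * n + 6 : ℕ) : ℤ) ∣ j := fun j hj =>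
    (ZMod.intCast_zmod_eq_zero_iff_dvd j (2 * n + 4 + 2)).1 hj
  refine ⟨fun h h' => h.parity τ h', fun a b => ?_, fun {a b z z'} haz haz' hz hz' hab => ?_,
    fun a => ?_, hthick.exists_adj⟩
  · obtain ⟨z, haz⟩ := hnb a
    obtain ⟨A, hA, hAaz, hAb⟩ := hap a z b haz
    obtain ⟨θ, hθ⟩ := h𝒜.exists_coord hA hAaz
    have h1 := hθ.reach_int (θ b).valMinAbs hAaz.fst_mem hAb
      (by rw [hθ.zero, zero_add, ZMod.coe_valMinAbs])
    have h2 := ZMod.natAbs_valMinAbs_le (θ b)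
    generalize (θ b).valMinAbs.natAbs = k at h1 h2
    have h3 : k ≤ n + 3 := by omega
    obtain ⟨j, hj | hj⟩ : ∃ j, k + 2 * j = n + 3 ∨ k + 2 * j = n + 2 :=
      ⟨(n + 3 - k) / 2, by omega⟩
    · exact Or.inl (hj ▸ h1.add_even ⟨z, haz⟩ j)
    · exact Or.inr (hj ▸ h1.add_even ⟨z, haz⟩ j)
  -- Retract from {a, z}: z goes to 1 and z' to -1. The two walks to b give displacements j + 1 and
  -- i - 1 from a that agree modulo 2n + 6.
  · by_contra hne
    obtain ⟨h, hh, hA'⟩ := h𝒜.exists_retraction haz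
    obtain ⟨A, hA, hAaz, hAb⟩ := hap a z b haz
    have hθ := hA' A hA hAaz
    have hz1 : h z' = -1 := by
      obtain ⟨B, hB, h1, h2⟩ := h𝒜.exists_common {a, z} {a, z'} (isSimplex_pair haz)
        (isSimplex_pair haz')
      have h1 := h1.adj haz
      have h2 := h2.adj haz'
      have hB' := hA' B hB h1
      rcases (hB'.adj a h1.fst_mem z' h2.snd_mem).1 h2 with h3 | h3
      · rw [hB'.zero] at h3; linear_combination -h3
      · rw [hB'.zero, sub_zero, ← hB'.one] at h3
        exact absurd (hB'.inj h2.snd_mem h1.snd_mem h3).symm hne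
    obtain ⟨j, hj, hj2, hj3⟩ := hz.exists_int hh
    obtain ⟨i, hi, hi2, hi3⟩ := hz'.exists_int hh
    rw [abs_le] at hj hi
    have h4 := hcast (j + 2 - i) (by
      push_cast; rw [hθ.one] at hj3; rw [hz1] at hi3; linear_combination hi3 - hj3)
    obtain ⟨c, hc⟩ := h4
    push_cast at hc hj hi hj2 hi2
    -- Since |j|, |i| ≤ n + 1, the number j + 2 - i is smaller in absolute value than 2n + 6, so i =
    -- j + 2 and |j + 1| ≤ n. This gives a walk of length n from a to b.
    have hc0 : c = 0 := by
      have h5 : c < 1 := by nlinarith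
      have h6 : -1 < c := by nlinarith
      omega
    subst hc0
    have h7 := hθ.reach_int (j + 1) hAaz.fst_mem hAb (by
      rw [hj3, hθ.one, hθ.zero]; push_cast; ring)
    obtain ⟨k, hk⟩ : ∃ k, (j + 1).natAbs + 2 * k = n := ⟨(n - (j + 1).natAbs) / 2, by omega⟩
    exact hab (hk ▸ h7.add_even ⟨z, haz⟩ k)
  -- The antipode of a in an apartment is opposite to a, because the retraction does not increase
  -- distances.
  · obtain ⟨z, haz⟩ := hnb a
    obtain ⟨h, hh, hA'⟩ := h𝒜.exists_retraction haz
    obtain ⟨A, hA, hAaz, -⟩ := hap a z a haz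
    have hθ := hA' A hA hAaz
    obtain ⟨b, hb, hb'⟩ := hθ.surj ((n + 3 : ℕ) : ZMod (2 * n + 4 + 2))
    have key : ∀ k : ℕ, k ≤ n + 2 → ¬ Reach G k a b := fun k hk hr => by
      obtain ⟨j, hj, hj2, hj3⟩ := hr.exists_int hh
      rw [abs_le] at hj
      rw [hb', hθ.zero, zero_add] at hj3
      obtain ⟨c, hc⟩ := hcast (n + 3 - j) (by push_cast; rw [← hj3]; push_cast; ring)
      push_cast at hc
      have h5 : c < 1 := by nlinarith
      have h6 : 0 < c := by nlinarith
      omega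
    exact ⟨b, key _ le_rfl, key _ (by omega)⟩

end Apartments

open Filter Topology Uniformity

universe u

/-! ### Opposition and projection. -/

section Opposite

variable {V : Type*} {G : SimpleGraph V} {n : ℕ}

/-- In an `(n + 3)`-gon, two vertices are opposite if their distance is `n + 3`. -/
def Opp (G : SimpleGraph V) (n : ℕ) (a b : V) : Prop :=
  ¬ Reach G (n + 2) a b ∧ ¬ Reach G (n + 1) a b

/-- In an `(n + 3)`-gon, two vertices are almost opposite if their distance is `n + 2`. -/
def Near (G : SimpleGraph V) (n : ℕ) (a b : V) : Prop :=
  ¬ Reach G (n + 3) a b ∧ ¬ Reach G n a b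

theorem Opp.symm {a b : V} (h : Opp G n a b) : Opp G n b a :=
  ⟨fun h' => h.1 h'.symm, fun h' => h.2 h'.symm⟩

theorem Near.symm {a b : V} (h : Near G n a b) : Near G n b a :=
  ⟨fun h' => h.1 h'.symm, fun h' => h.2 h'.symm⟩

namespace IsGenPolygon

variable (hG : IsGenPolygon G n)
include hG

theorem near_of_reach {a b : V} (h : Reach G (n + 2) a b) (h' : ¬ Reach G n a b) :
    Near G n a b :=
  ⟨fun h'' => by have := hG.parity h h''; omega, h'⟩

theorem opp_near {a b z : V} (h : Opp G n a b) (hz : G.Adj b z) : Near G n a z := by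
  refine ⟨fun h' => ?_, fun h' => h.2 (h'.concat hz.symm)⟩
  have h1 := (hG.diam a b).resolve_right h.1
  have := hG.parity h1 (h'.concat hz.symm)
  omega

theorem near_opp {a b z : V} (h : Opp G n a b) (hz : G.Adj a z) : Near G n z b :=
  (hG.opp_near h.symm hz).symm

theorem exists_proj {a b : V} (h : Near G n a b) : ∃ z, G.Adj a z ∧ Reach G (n + 1) z b :=
  (hG.diam a b).resolve_left h.1

theorem proj_unique {a b z z' : V} (h : Near G n a b) (hz : G.Adj a z)
    (hzb : Reach G (n + 1) z b) (hz' : G.Adj a z') (hzb' : Reach G (n + 1) z' b) : z = z' :=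
  hG.uniq hz hz' hzb hzb' h.2

theorem opp_of_ne {a b z z' : V} (h : Near G n a b) (hz : G.Adj a z)
    (hzb : Reach G (n + 1) z b) (hz' : G.Adj a z') (hne : z' ≠ z) : Opp G n z' b := by
  refine ⟨fun h' => ?_, fun h' => hne (hG.proj_unique h hz' h' hz hzb)⟩
  have h1 : Reach G (n + 2) a b := ⟨z, hz, hzb⟩
  have := hG.parity h1 (h'.cons hz')
  omega

/-- The degenerate case of the composite of two perspectivities, from the neighbours of `l` via
those of `c` to those of `l'`, when `c` and `l'` are not opposite. -/
theorem degenerate_proj {l o x c l' p z w : V} (hcl : Opp G n c l) (hlo : G.Adj l o)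
    (hlx : G.Adj l x) (hxo : x ≠ o) (hol' : G.Adj o l') (hl'c : Reach G (n + 1) l' c)
    (hl'p : G.Adj l' p) (hpc : Reach G n p c) (hcz : G.Adj c z) (hzx : Reach G (n + 1) z x)
    (hl'w : G.Adj l' w) (hwz : Reach G (n + 1) w z) : w = p := by
  have hnear : Near G n l' z := by
    refine hG.near_of_reach (hl'c.concat hcz) fun h => hxo ?_
    exact hG.proj_unique (hG.near_opp hcl hcz).symm hlx hzx.symm hlo (h.cons hol')
  exact hG.proj_unique hnear hl'w hwz hl'p (hpc.concat hcz)

end IsGenPolygon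

end Opposite

/-! ### Limits along ultrafilters in compact spaces. -/

section Ultralimit

/-- The limit of a family in a compact space along an ultrafilter. -/
noncomputable def ulim {ι X : Type*} [TopologicalSpace X] (U : Ultrafilter ι) (x : ι → X) : X :=
  (U.map x).lim

variable {ι X : Type*} [TopologicalSpace X] [CompactSpace X] {U : Ultrafilter ι} {x y : ι → X}

theorem tendsto_ulim (U : Ultrafilter ι) (x : ι → X) : Tendsto x U (𝓝 (ulim U x)) :=
  (U.map x).le_nhds_lim

theorem ulim_mem {C : Set X} (hC : IsClosed C) (h : ∀ᶠ i in U, x i ∈ C) : ulim U x ∈ C :=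
  hC.mem_of_tendsto (tendsto_ulim U x) h

theorem ulim_eq [T2Space X] {a : X} (h : Tendsto x U (𝓝 a)) : ulim U x = a :=
  tendsto_nhds_unique (tendsto_ulim U x) h

theorem ulim_const [T2Space X] (a : X) : ulim U (fun _ : ι => a) = a :=
  ulim_eq tendsto_const_nhds

theorem ulim_congr [T2Space X] (h : ∀ᶠ i in U, x i = y i) : ulim U x = ulim U y :=
  ulim_eq ((tendsto_ulim U y).congr' (h.mono fun _ hi => hi.symm))

end Ultralimit

/-- A thick generalized `(n + 3)`-gon whose adjacency relation is closed. -/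
structure IsClosedPolygon {V : Type*} [TopologicalSpace V] (G : SimpleGraph V) (n : ℕ) : Prop
    extends IsGenPolygon G n where
  closed_adj : IsClosed {p : V × V | G.Adj p.1 p.2}

/-! ### Closedness of bounded distance and continuity of projections. -/

section Closed

variable {V : Type*} [TopologicalSpace V] [CompactSpace V] [T2Space V] {G : SimpleGraph V} {n : ℕ}
  {ι : Type*} {U : Ultrafilter ι} {x y : ι → V}

namespace IsClosedPolygon

variable (hG : IsClosedPolygon G n)
include hG

omit [T2Space V] in
theorem ulim_adj (h : ∀ᶠ i in U, G.Adj (x i) (y i)) : G.Adj (ulim U x) (ulim U y) :=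
  hG.closed_adj.mem_of_tendsto ((tendsto_ulim U x).prodMk_nhds (tendsto_ulim U y)) h

theorem ulim_reach {k : ℕ} (h : ∀ᶠ i in U, Reach G k (x i) (y i)) :
    Reach G k (ulim U x) (ulim U y) := by
  induction k generalizing x with
  | zero => exact ulim_congr h
  | succ k ih =>
    have : ∀ i, ∃ z, Reach G (k + 1) (x i) (y i) → G.Adj (x i) z ∧ Reach G k z (y i) := fun i => by
      by_cases hi : Reach G (k + 1) (x i) (y i)
      · obtain ⟨z, hz⟩ := hi
        exact ⟨z, fun _ => hz⟩
      · exact ⟨x i, fun h => absurd h hi⟩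
    choose z hz using this
    exact ⟨ulim U z, hG.ulim_adj (h.mono fun i hi => (hz i hi).1),
      ih (h.mono fun i hi => (hz i hi).2)⟩

theorem isClosed_reach (k : ℕ) : IsClosed {p : V × V | Reach G k p.1 p.2} := by
  rw [isClosed_iff_ultrafilter]
  intro p u hu hs
  have h := hG.ulim_reach (U := u) (x := Prod.fst) (y := Prod.snd) hs
  rwa [ulim_eq ((continuous_fst.tendsto p).mono_left hu),
    ulim_eq ((continuous_snd.tendsto p).mono_left hu)] at h

theorem isOpen_opp : IsOpen {p : V × V | Opp G n p.1 p.2} :=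
  (hG.isClosed_reach (n + 2)).isOpen_compl.inter (hG.isClosed_reach (n + 1)).isOpen_compl

theorem tendsto_opp {f : Filter ι} {a b : V} (h : Opp G n a b) (hx : Tendsto x f (𝓝 a))
    (hy : Tendsto y f (𝓝 b)) : ∀ᶠ i in f, Opp G n (x i) (y i) :=
  (hx.prodMk_nhds hy).eventually (hG.isOpen_opp.mem_nhds h)

/-- The neighbours of a vertex can be moved along with the vertex. -/
theorem exists_lift {t : V} (ht : G.Adj (ulim U x) t) :
    ∃ t' : ι → V, (∀ᶠ i in U, G.Adj (x i) (t' i)) ∧ ulim U t' = t := by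
  -- With r opposite the limit and z the neighbour of r nearest to t, the lift is the projection of
  -- z to `x i`. It is defined for almost all i because opposition is open.
  obtain ⟨r, hr⟩ := hG.exists_opp (ulim U x)
  have hr : Opp G n (ulim U x) r := hr
  obtain ⟨z, hz, hzt⟩ := hG.exists_proj (hG.near_opp hr ht).symm
  have hev := hG.tendsto_opp hr (tendsto_ulim U x) tendsto_const_nhds
  have : ∀ i, ∃ t', Opp G n (x i) r → G.Adj (x i) t' ∧ Reach G (n + 1) t' z := fun i => by
    by_cases hi : Opp G n (x i) r
    · obtain ⟨t', h⟩ := hG.exists_proj (hG.opp_near hi hz)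
      exact ⟨t', fun _ => h⟩
    · exact ⟨x i, fun h => absurd h hi⟩
  choose t' ht' using this
  have h1 : ∀ᶠ i in U, G.Adj (x i) (t' i) := hev.mono fun i hi => (ht' i hi).1
  refine ⟨t', h1, ?_⟩
  have h2 := hG.ulim_reach (U := U) (x := t') (y := fun _ => z) (hev.mono fun i hi => (ht' i hi).2)
  rw [ulim_const] at h2
  exact hG.proj_unique (hG.opp_near hr hz) (hG.ulim_adj h1) h2 ht hzt.symm

theorem eventually_exists_adj {a t : V} (ht : G.Adj a t) {T : Set V} (hT : T ∈ 𝓝 t) :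
    ∀ᶠ a' in 𝓝 a, ∃ t' ∈ T, G.Adj a' t' := by
  refine mem_iff_ultrafilter.2 fun u hu => ?_
  have hua : Tendsto id (u : Filter V) (𝓝 a) := hu
  by_contra hcon
  have hcon := Ultrafilter.eventually_not.2 hcon
  obtain ⟨t', h1, h2⟩ := hG.exists_lift (U := u) (x := id) (t := t) (by rwa [ulim_eq hua])
  have h3 : ∀ᶠ i in u, ¬ ∃ t' ∈ T, G.Adj i t' := hcon
  have h4 : ∀ᶠ i in (u : Filter V), t' i ∈ T := tendsto_ulim u t' (h2 ▸ hT)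
  obtain ⟨i, hi1, hi2, hi3⟩ := (h1.and (h3.and h4)).exists
  exact hi2 ⟨t' i, hi3, hi1⟩

/-- The projection of `c` to `a` depends continuously on `a`. -/
theorem eventually_mem_of_proj {a b c : V} (h : Near G n a c) (hab : G.Adj a b)
    (hbc : Reach G (n + 1) b c) {B : Set V} (hB : B ∈ 𝓝 b) :
    ∀ᶠ a' in 𝓝 a, ∀ b', G.Adj a' b' → Reach G (n + 1) b' c → b' ∈ B := by
  refine mem_iff_ultrafilter.2 fun u hu => ?_
  have hua : Tendsto id (u : Filter V) (𝓝 a) := hu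
  by_contra hcon
  have hcon := Ultrafilter.eventually_not.2 hcon
  have h3 : ∀ᶠ i in (u : Filter V), ∃ b', G.Adj i b' ∧ Reach G (n + 1) b' c ∧ b' ∉ B := by
    have : ∀ᶠ i in (u : Filter V), ¬ ∀ b', G.Adj i b' → Reach G (n + 1) b' c → b' ∈ B :=
      hcon
    filter_upwards [this] with i hi
    push Not at hi
    exact hi
  have : ∀ i, ∃ b', (∃ b', G.Adj i b' ∧ Reach G (n + 1) b' c ∧ b' ∉ B) →
      G.Adj i b' ∧ Reach G (n + 1) b' c ∧ b' ∉ B := fun i => by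
    by_cases hi : ∃ b', G.Adj i b' ∧ Reach G (n + 1) b' c ∧ b' ∉ B
    · exact hi.imp fun b' hb' _ => hb'
    · exact ⟨i, fun h => absurd h hi⟩
  choose b' hb' using this
  have h1 := hG.ulim_adj (U := u) (x := id) (y := b') (h3.mono fun i hi => (hb' i hi).1)
  have h2 := hG.ulim_reach (U := u) (x := b') (y := fun _ => c)
    (h3.mono fun i hi => (hb' i hi).2.1)
  rw [ulim_eq hua] at h1
  rw [ulim_const] at h2
  have h4 := hG.proj_unique h hab hbc h1 h2
  have h5 : ∀ᶠ i in (u : Filter V), b' i ∈ B := tendsto_ulim u b' (h4 ▸ hB)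
  obtain ⟨i, hi1, hi2⟩ := (h3.and h5).exists
  exact (hb' i hi1).2.2 hi2

/-- If `o` is not isolated among the neighbours of `l`, then `c` is not isolated among the
neighbours of `q`. -/
theorem exists_ultrafilter_of_nonisolated {l o q c : V} (hlo : G.Adj l o) (hqo : Opp G n q o)
    (hqc : G.Adj q c) (hcl : Opp G n c l) {Y : Ultrafilter V} (hY : (Y : Filter V) ≤ 𝓝 o)
    (hY' : ∀ᶠ y in Y, G.Adj l y ∧ y ≠ o) :
    ∃ W : Ultrafilter V, (W : Filter V) ≤ 𝓝 c ∧ ∀ᶠ c' in W, G.Adj q c' ∧ c' ≠ c := by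
  have hoc : Near G n o c := (hG.opp_near hcl hlo).symm
  obtain ⟨l', hol', hl'c⟩ := hG.exists_proj hoc
  obtain ⟨u, hlu, huo, -⟩ := hG.thick l o o
  obtain ⟨p, hup, hpc⟩ := hG.exists_proj (hG.opp_near hcl hlu).symm
  obtain ⟨v, huv, hvp, hvl⟩ := hG.thick u p l
  have hvc : Opp G n v c := hG.opp_of_ne (hG.opp_near hcl hlu).symm hup hpc huv hvp
  -- A chain of projections leads from y in D(l) to c' in D(q): d is y projected to c, z is v
  -- projected to d, x is z projected to o, and c' is x projected to q.
  have hex : ∀ y, ∃ c' : V × V × V × V, G.Adj l y ∧ y ≠ o →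
      G.Adj c c'.1 ∧ Reach G (n + 1) c'.1 y ∧ G.Adj c'.1 c'.2.1 ∧ Reach G (n + 1) c'.2.1 v ∧
      G.Adj o c'.2.2.1 ∧ Reach G (n + 1) c'.2.2.1 c'.2.1 ∧ G.Adj q c'.2.2.2 ∧
      Reach G (n + 1) c'.2.2.2 c'.2.2.1 := fun y => by
    by_cases hy : G.Adj l y ∧ y ≠ o
    · obtain ⟨d, hcd, hdy⟩ := hG.exists_proj (hG.opp_near hcl hy.1)
      obtain ⟨z, hdz, hzv⟩ := hG.exists_proj (hG.near_opp hvc.symm hcd)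
      obtain ⟨x, hox, hxz⟩ := (hG.diam o z).resolve_left fun h => by
        have h1 : Reach G (n + 1 + 1) o c := hl'c.cons hol'
        have := hG.parity h ((h1.concat hcd).concat hdz)
        omega
      obtain ⟨c', hqc', hc'x⟩ := hG.exists_proj (hG.opp_near hqo hox)
      exact ⟨(d, z, x, c'), fun _ => ⟨hcd, hdy, hdz, hzv, hox, hxz, hqc', hc'x⟩⟩
    · exact ⟨(o, o, o, o), fun h => absurd h hy⟩
  choose f hf using hex
  refine ⟨Y.map fun y => (f y).2.2.2, ?_, ?_⟩
  · have hd := hG.ulim_adj (U := Y) (x := fun _ => c) (y := fun y => (f y).1)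
      (hY'.mono fun y hy => (hf y hy).1)
    have hdy := hG.ulim_reach (U := Y) (x := fun y => (f y).1) (y := id)
      (hY'.mono fun y hy => (hf y hy).2.1)
    have hdz := hG.ulim_adj (U := Y) (x := fun y => (f y).1) (y := fun y => (f y).2.1)
      (hY'.mono fun y hy => (hf y hy).2.2.1)
    have hzv := hG.ulim_reach (U := Y) (x := fun y => (f y).2.1) (y := fun _ => v)
      (hY'.mono fun y hy => (hf y hy).2.2.2.1)
    have hox := hG.ulim_adj (U := Y) (x := fun _ => o) (y := fun y => (f y).2.2.1)
      (hY'.mono fun y hy => (hf y hy).2.2.2.2.1)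
    have hxz := hG.ulim_reach (U := Y) (x := fun y => (f y).2.2.1) (y := fun y => (f y).2.1)
      (hY'.mono fun y hy => (hf y hy).2.2.2.2.2.1)
    have hqc' := hG.ulim_adj (U := Y) (x := fun _ => q) (y := fun y => (f y).2.2.2)
      (hY'.mono fun y hy => (hf y hy).2.2.2.2.2.2.1)
    have hc'x := hG.ulim_reach (U := Y) (x := fun y => (f y).2.2.2) (y := fun y => (f y).2.2.1)
      (hY'.mono fun y hy => (hf y hy).2.2.2.2.2.2.2)
    have hlim := tendsto_ulim Y fun y => (f y).2.2.2
    rw [ulim_const] at hd hzv hox hqc'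
    rw [ulim_eq (x := id) hY] at hdy
    generalize ulim Y (fun y => (f y).1) = d at *
    generalize ulim Y (fun y => (f y).2.1) = z at *
    generalize ulim Y (fun y => (f y).2.2.1) = x at *
    generalize ulim Y (fun y => (f y).2.2.2) = c' at *
    -- In the limit d is the projection of o to c, which lies within n of l'; this forces x = l' and
    -- then c' = c.
    have hld : Near G n l d := (hG.near_opp hcl hd).symm
    have hl'd : Reach G n l' d := by
      obtain ⟨w, how, hwd⟩ := hdy.symm
      rwa [hG.proj_unique hoc hol' hl'c how (hwd.concat hd.symm)]
    have hoz : ¬ Reach G n o z := fun h => by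
      refine hvl (hG.uniq huv hlu.symm hzv.symm (h.cons hlo) fun h' => huo ?_)
      exact hG.proj_unique hld hlu (h'.concat hdz.symm) hlo hdy.symm
    have hxl' : x = l' := hG.uniq hox hol' hxz (hl'd.concat hdz) hoz
    rw [hxl'] at hc'x
    have : c' = c := hG.proj_unique (hG.opp_near hqo hol') hqc' hc'x hqc hl'c.symm
    rwa [this] at hlim
  · change ∀ᶠ y in (Y : Filter V), G.Adj q (f y).2.2.2 ∧ (f y).2.2.2 ≠ c
    filter_upwards [hY'] with y hy
    obtain ⟨hcd, hdy, hdz, hzv, hox, hxz, hqc', hc'x⟩ := hf y hy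
    -- If c' = c, then x = l'. As y ≠ o excludes a walk of length n from d to l', uniqueness of
    -- projections gives z = c, which contradicts that c is opposite v.
    refine ⟨hqc', fun heq => ?_⟩
    rw [heq] at hc'x
    have hxl' := hG.proj_unique hoc hox hc'x.symm hol' hl'c
    rw [hxl'] at hxz
    have hzc : (f y).2.1 = c := by
      refine hG.uniq hdz hcd.symm hxz.symm hl'c.symm fun h => hy.2 ?_
      exact hG.proj_unique (hG.near_opp hcl hcd).symm hy.1 hdy.symm hlo
        ((h.symm.cons hol'))
    rw [hzc] at hzv
    exact hvc.2 hzv.symm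

end IsClosedPolygon

end Closed

/-- The limit of the images of a family of vertices under a family of automorphisms. -/
noncomputable def ulimMap {V ι : Type*} [TopologicalSpace V] {G : SimpleGraph V}
    (U : Ultrafilter ι) (Φ : ι → (G ≃g G)) (x : ι → V) : V :=
  ulim U fun i => Φ i (x i)

namespace IsClosedPolygon

/-! ### Equicontinuity on a row at a non-isolated vertex. -/

section Core

variable {V : Type*} [TopologicalSpace V] [CompactSpace V] [T2Space V] {G : SimpleGraph V} {n : ℕ}
  {ι : Type*} {U : Ultrafilter ι} {Φ : ι → (G ≃g G)} {x y : ι → V}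

omit [T2Space V] in
theorem ulimMap_adj (hG : IsClosedPolygon G n) (h : ∀ᶠ i in U, G.Adj (x i) (y i)) :
    G.Adj (ulimMap U Φ x) (ulimMap U Φ y) :=
  hG.ulim_adj (h.mono fun i hi => (Φ i).map_adj_iff.2 hi)

theorem ulimMap_reach (hG : IsClosedPolygon G n) {k : ℕ}
    (h : ∀ᶠ i in U, Reach G k (x i) (y i)) : Reach G k (ulimMap U Φ x) (ulimMap U Φ y) :=
  hG.ulim_reach (h.mono fun i hi => hi.map (Φ i))

variable (U Φ) in
/-- The value of the limit of the automorphisms at a constant family. -/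
noncomputable abbrev ulimConst (v : V) : V := ulimMap U Φ fun _ => v

omit [T2Space V] in
theorem ulimConst_adj (hG : IsClosedPolygon G n) {v w : V} (h : G.Adj v w) :
    G.Adj (ulimConst U Φ v) (ulimConst U Φ w) :=
  hG.ulimMap_adj (.of_forall fun _ => h)

theorem ulimConst_reach (hG : IsClosedPolygon G n) {k : ℕ} {v w : V} (h : Reach G k v w) :
    Reach G k (ulimConst U Φ v) (ulimConst U Φ w) :=
  hG.ulimMap_reach (.of_forall fun _ => h)

omit [CompactSpace V] [T2Space V] in
/-- The composite of the perspectivities via `c`, from the neighbours of `l` to those of `l'`,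
applied to a family of neighbours of `l`. -/
theorem exists_projectivity (hG : IsClosedPolygon G n) {l l' c : V}
    (hx : ∀ᶠ i in U, G.Adj l (x i)) (hcl : Opp G n c l) (hcl' : Opp G n c l') :
    ∃ z w : ι → V, (∀ᶠ i in U, G.Adj c (z i)) ∧ (∀ᶠ i in U, Reach G (n + 1) (z i) (x i)) ∧
      (∀ᶠ i in U, G.Adj l' (w i)) ∧ ∀ᶠ i in U, Reach G (n + 1) (w i) (z i) := by
  have hex : ∀ i, ∃ p : V × V, G.Adj l (x i) → G.Adj c p.1 ∧ Reach G (n + 1) p.1 (x i) ∧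
      G.Adj l' p.2 ∧ Reach G (n + 1) p.2 p.1 := fun i => by
    by_cases hi : G.Adj l (x i)
    · obtain ⟨z, hcz, hzx⟩ := hG.exists_proj (hG.opp_near hcl hi)
      obtain ⟨w, hw, hwz⟩ := hG.exists_proj (hG.opp_near hcl'.symm hcz)
      exact ⟨(z, w), fun _ => ⟨hcz, hzx, hw, hwz⟩⟩
    · exact ⟨(l, l), fun h => absurd h hi⟩
  choose p hp using hex
  exact ⟨fun i => (p i).1, fun i => (p i).2, hx.mono fun i hi => (hp i hi).1,
    hx.mono fun i hi => (hp i hi).2.1, hx.mono fun i hi => (hp i hi).2.2.1,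
    hx.mono fun i hi => (hp i hi).2.2.2⟩

/-- Automorphisms close to the identity are equicontinuous at a vertex `o` which is not isolated
among the neighbours of `l`. -/
theorem ulimMap_eq_of_nonisolated (hG : IsClosedPolygon G n) {l o q c l' p t : V}
    (hlo : G.Adj l o) (hqo : Opp G n q o) (hqc : G.Adj q c) (hcl : Opp G n c l)
    (hol' : G.Adj o l') (hl'c : Reach G (n + 1) l' c) (hl'p : G.Adj l' p) (hpc : Reach G n p c)
    (hF : Opp G n (ulimConst U Φ q) (ulimConst U Φ o))
    {B : Set V} (hB : IsClosed B) (hBl : ∀ s ∈ B, Opp G n s (ulimConst U Φ l))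
    (hcB : ∀ᶠ c' in 𝓝 c, ulimConst U Φ c' ∈ B)
    {P₀ P₁ : Set V} (hP₀ : IsClosed P₀) (hP₁ : IsClosed P₁) (hdisj : Disjoint P₀ P₁)
    (h₀ : ∀ x, ulim U x = o → ulimMap U Φ x ∈ P₀)
    (h₁ : ∀ᶠ a in 𝓝 p, ∀ x, ulim U x = a → ulimMap U Φ x ∈ P₁)
    (ht₀ : t ∉ P₀) (ht₁ : t ∉ P₁) (ht : G.Adj (ulimConst U Φ l') t)
    {W : Ultrafilter V} (hW : (W : Filter V) ≤ 𝓝 c)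
    (hW' : ∀ᶠ c' in W, G.Adj q c' ∧ c' ≠ c) {e : ι → V} (he : ∀ᶠ i in U, G.Adj l (e i))
    (heo : ulim U e = o) : ulimMap U Φ e = ulimConst U Φ o := by
  by_contra hne
  have hWid : Tendsto id (W : Filter V) (𝓝 c) := hW
  have hql' : Near G n q l' := hG.opp_near hqo hol'
  -- c is the projection of l' to q, so every other neighbour of q is opposite l'.
  have hev : ∀ᶠ c' in W, Opp G n c' l ∧ Opp G n c' l' := by
    filter_upwards [hW', hG.tendsto_opp hcl hWid tendsto_const_nhds] with c' h1 h2
    exact ⟨h2, hG.opp_of_ne hql' hqc hl'c.symm h1.1 h1.2⟩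
  set F := ulimConst U Φ with hFdef
  set s := ulim W F with hs
  have hsB : s ∈ B := ulim_mem hB (hW hcB)
  have hsl : Opp G n s (F l) := hBl s hsB
  have hcl_F : Opp G n (F c) (F l) := hBl _ hcB.self_of_nhds
  have hqs : G.Adj (F q) s := by
    have := hG.ulim_adj (U := W) (x := fun _ => F q) (y := F)
      (hW'.mono fun c' h => hG.ulimConst_adj h.1)
    rwa [ulim_const] at this
  have key : ∀ x : ι → V, (∀ᶠ i in U, G.Adj l (x i)) → ∃ ζ γ, G.Adj s ζ ∧
      Reach G (n + 1) ζ (ulimMap U Φ x) ∧ G.Adj (F l') γ ∧ Reach G (n + 1) γ ζ ∧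
      (γ ∈ P₀ ∨ γ ∈ P₁) ∧ (ulim U x = o → γ ∈ P₀) := by
    intro x hx
    have hex : ∀ c', ∃ r : (ι → V) × (ι → V), Opp G n c' l ∧ Opp G n c' l' →
        (∀ᶠ i in U, G.Adj c' (r.1 i)) ∧ (∀ᶠ i in U, Reach G (n + 1) (r.1 i) (x i)) ∧
        (∀ᶠ i in U, G.Adj l' (r.2 i)) ∧ ∀ᶠ i in U, Reach G (n + 1) (r.2 i) (r.1 i) := fun c' => by
      by_cases h : Opp G n c' l ∧ Opp G n c' l'
      · obtain ⟨z, w, h'⟩ := hG.exists_projectivity hx h.1 h.2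
        exact ⟨(z, w), fun _ => h'⟩
      · exact ⟨(x, x), fun h' => absurd h' h⟩
    choose r hr using hex
    have h1 := hG.ulim_adj (U := W) (x := F) (y := fun c' => ulimMap U Φ (r c').1)
      (hev.mono fun c' h => hG.ulimMap_adj (hr c' h).1)
    have h2 := hG.ulim_reach (U := W) (x := fun c' => ulimMap U Φ (r c').1)
      (y := fun _ => ulimMap U Φ x) (hev.mono fun c' h => hG.ulimMap_reach (hr c' h).2.1)
    have h3 := hG.ulim_adj (U := W) (x := fun _ => F l') (y := fun c' => ulimMap U Φ (r c').2)
      (hev.mono fun c' h => hG.ulimMap_adj (hr c' h).2.2.1)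
    have h4 := hG.ulim_reach (U := W) (x := fun c' => ulimMap U Φ (r c').2)
      (y := fun c' => ulimMap U Φ (r c').1) (hev.mono fun c' h => hG.ulimMap_reach (hr c' h).2.2.2)
    rw [ulim_const] at h2 h3
    -- o is a neighbour of both l and l', hence fixed by each projectivity via c'.
    have h5 : ulim U x = o → ulim W (fun c' => ulimMap U Φ (r c').2) ∈ P₀ := fun hxo => by
      refine ulim_mem hP₀ (hev.mono fun c' h => h₀ _ ?_)
      have g1 := hG.ulim_adj (hr c' h).1
      have g2 := hG.ulim_reach (hr c' h).2.1
      have g3 := hG.ulim_adj (hr c' h).2.2.1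
      have g4 := hG.ulim_reach (hr c' h).2.2.2
      rw [ulim_const] at g1 g3
      rw [hxo] at g2
      exact hG.proj_unique (hG.opp_near h.2.symm g1) g3 g4 hol'.symm g2.symm
    refine ⟨_, _, h1, h2, h3, h4, ?_, h5⟩
    by_cases hxo : ulim U x = o
    · exact Or.inl (h5 hxo)
    -- As c' → c the projectivity degenerates and sends a point other than o towards p.
    · refine Or.inr (ulim_mem hP₁ ?_)
      have g0 := hG.ulim_adj hx
      have g1 := hG.ulim_adj (U := W) (x := id) (y := fun c' => ulim U (r c').1)
        (hev.mono fun c' h => by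
          have := hG.ulim_adj (hr c' h).1
          rwa [ulim_const] at this)
      have g2 := hG.ulim_reach (U := W) (x := fun c' => ulim U (r c').1) (y := fun _ => ulim U x)
        (hev.mono fun c' h => hG.ulim_reach (hr c' h).2.1)
      have g3 := hG.ulim_adj (U := W) (x := fun _ => l') (y := fun c' => ulim U (r c').2)
        (hev.mono fun c' h => by
          have := hG.ulim_adj (hr c' h).2.2.1
          rwa [ulim_const] at this)
      have g4 := hG.ulim_reach (U := W) (x := fun c' => ulim U (r c').2)
        (y := fun c' => ulim U (r c').1) (hev.mono fun c' h => hG.ulim_reach (hr c' h).2.2.2)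
      rw [ulim_const] at g0 g2 g3
      rw [ulim_eq hWid] at g1
      have g5 := hG.degenerate_proj hcl hlo g0 hxo hol' hl'c hl'p hpc g1 g2 g3 g4
      have g6 := tendsto_ulim W fun c' => ulim U (r c').2
      rw [g5] at g6
      exact (g6.eventually h₁).mono fun c' h => h _ rfl
  -- If s = F c, the image projectivity degenerates too: since lim Φ e ≠ F o, it sends lim Φ e to F
  -- p ∈ P₁, whereas e → o puts the value in P₀.
  have hsc : s ≠ F c := by
    intro hsc
    obtain ⟨ζ, γ, h1, h2, h3, h4, -, h5⟩ := key e he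
    rw [hsc] at h1
    have h6 := hG.ulimMap_adj (Φ := Φ) he
    have h7 := hG.degenerate_proj hcl_F (hG.ulimConst_adj hlo) h6 hne (hG.ulimConst_adj hol')
      (hG.ulimConst_reach hl'c) (hG.ulimConst_adj hl'p) (hG.ulimConst_reach hpc) h1 h2 h3 h4
    exact Set.disjoint_left.1 hdisj (h5 heo) (h7 ▸ h₁.self_of_nhds _ (ulim_const p))
  have hsl' : Opp G n s (F l') := hG.opp_of_ne (hG.opp_near hF (hG.ulimConst_adj hol'))
    (hG.ulimConst_adj hqc) (hG.ulimConst_reach hl'c).symm hqs hsc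
  -- Now s is opposite both F l and F l', so t can be pulled back to some κ in D(F l). Lifting κ to
  -- neighbours of `Φ i l` and applying the inverses yields a family in D(l) whose value under `key`
  -- is t, outside P₀ ∪ P₁.
  obtain ⟨ζ, hsζ, hζt⟩ := hG.exists_proj (hG.opp_near hsl' ht)
  obtain ⟨κ, hlκ, hκζ⟩ := hG.exists_proj (hG.opp_near hsl.symm hsζ)
  obtain ⟨κ', hκ', hκ'κ⟩ := hG.exists_lift (U := U) (x := fun i => Φ i l) hlκ
  set x : ι → V := fun i => (Φ i).symm (κ' i) with hxdef
  have hx : ∀ᶠ i in U, G.Adj l (x i) := hκ'.mono fun i hi => by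
    rw [← (Φ i).map_adj_iff]
    simpa [x] using hi
  have hxκ : ulimMap U Φ x = κ := by
    rw [← hκ'κ]
    simp [ulimMap, x]
  obtain ⟨ζ', γ, h1, h2, h3, h4, h5, -⟩ := key x hx
  rw [hxκ] at h2
  have hζ' : ζ' = ζ := hG.proj_unique (hG.opp_near hsl hlκ) h1 h2 hsζ hκζ.symm
  rw [hζ'] at h4
  have hγ : γ = t := hG.proj_unique (hG.opp_near hsl'.symm hsζ) h3 h4 ht hζt.symm
  rw [hγ] at h5
  exact h5.elim ht₀ ht₁

end Core

end IsClosedPolygon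

/-- A family of automorphisms which is, in the limit, `W`-close to the identity. -/
def IsClose {V ι : Type*} [TopologicalSpace V] {G : SimpleGraph V} (W : Set (V × V))
    (U : Ultrafilter ι) (Φ : ι → (G ≃g G)) : Prop :=
  ∀ x : ι → V, (ulim U x, ulimMap U Φ x) ∈ W

theorem IsClose.mono {V ι : Type*} [TopologicalSpace V] {G : SimpleGraph V} {W W' : Set (V × V)}
    {U : Ultrafilter ι} {Φ : ι → (G ≃g G)} (h : IsClose W U Φ) (hW : W ⊆ W') : IsClose W' U Φ :=
  fun x => hW (h x)

theorem IsClose.const {V ι : Type*} [TopologicalSpace V] [CompactSpace V] [T2Space V]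
    {G : SimpleGraph V} {W : Set (V × V)} {U : Ultrafilter ι} {Φ : ι → (G ≃g G)}
    (h : IsClose W U Φ) (v : V) : (v, ulimMap U Φ fun _ => v) ∈ W := by
  have := h fun _ => v
  rwa [ulim_const] at this

theorem exists_entourage_of_mem_nhds {V : Type*} [UniformSpace V] {v : V} {P : Set V}
    (hP : P ∈ 𝓝 v) : ∃ W ∈ 𝓤 V, ∀ᶠ a in 𝓝 v, ∀ b, (a, b) ∈ W → b ∈ P := by
  obtain ⟨W, hW, hWP⟩ := UniformSpace.mem_nhds_iff.1 hP
  obtain ⟨W', hW', hW'W⟩ := comp_mem_uniformity_sets hW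
  refine ⟨W', hW', ?_⟩
  filter_upwards [UniformSpace.ball_mem_nhds v hW'] with a ha b hab
  exact hWP (hW'W ⟨a, ha, hab⟩)

/-- Families of automorphisms which are `W`-close to the identity are equicontinuous at `o` on the
set of neighbours of `l`. -/
def RowEquicontinuous {V : Type u} [TopologicalSpace V] (G : SimpleGraph V) (W : Set (V × V))
    (l o : V) : Prop :=
  ∀ (ι : Type u) (U : Ultrafilter ι) (Φ : ι → (G ≃g G)), IsClose W U Φ → ∀ e : ι → V,
    (∀ᶠ i in U, G.Adj l (e i)) → ulim U e = o → ulimMap U Φ e = ulimMap U Φ fun _ => o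

theorem RowEquicontinuous.mono {V : Type u} [TopologicalSpace V] {G : SimpleGraph V}
    {W W' : Set (V × V)} {l o : V} (h : RowEquicontinuous G W' l o) (hW : W ⊆ W') :
    RowEquicontinuous G W l o :=
  fun ι U Φ hΦ => h ι U Φ (hΦ.mono hW)

/-! ### Uniform equicontinuity near the identity. -/

namespace IsClosedPolygon

variable {V : Type u} [UniformSpace V] [CompactSpace V] [T2Space V] {G : SimpleGraph V} {n : ℕ}
  (hG : IsClosedPolygon G n)
include hG

theorem exists_rowEquicontinuous_near {l o : V} (hlo : G.Adj l o) :
    ∃ W ∈ 𝓤 V, ∀ᶠ o' in 𝓝 o, G.Adj l o' → RowEquicontinuous G W l o' := by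
  obtain ⟨q, hq⟩ := hG.exists_opp o
  have hqo : Opp G n q o := Opp.symm hq
  have hql : Near G n q l := hG.opp_near hqo hlo.symm
  obtain ⟨d, hqd, hdl⟩ := hG.exists_proj hql
  obtain ⟨c, hqc, hcd, -⟩ := hG.thick q d d
  have hcl : Opp G n c l := hG.opp_of_ne hql hqd hdl hqc hcd
  have hoc : Near G n o c := (hG.opp_near hcl hlo).symm
  obtain ⟨l', hol', hl'c⟩ := hG.exists_proj hoc
  obtain ⟨p, hl'p, hpc⟩ := hl'c
  have hl'c : Reach G (n + 1) l' c := ⟨p, hl'p, hpc⟩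
  have hpo : p ≠ o := fun h => hcl.2 ((h ▸ hpc).cons hlo).symm
  -- Thickness supplies the third neighbour r of l' that P₀ and P₁ have to miss.
  obtain ⟨r, hl'r, hro, hrp⟩ := hG.thick l' o p
  obtain ⟨P₀, hP₀, hP₀c, hP₀s⟩ := exists_mem_nhds_isClosed_subset
    ((isOpen_compl_singleton.inter isOpen_compl_singleton).mem_nhds
      (⟨hpo.symm, hro.symm⟩ : o ∈ ({p}ᶜ ∩ {r}ᶜ : Set V)))
  obtain ⟨P₁, hP₁, hP₁c, hP₁s⟩ := exists_mem_nhds_isClosed_subset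
    ((hP₀c.isOpen_compl.inter isOpen_compl_singleton).mem_nhds
      (⟨fun h => (hP₀s h).1 rfl, hrp.symm⟩ : p ∈ (P₀ᶜ ∩ {r}ᶜ : Set V)))
  have hT : (P₀ ∪ P₁)ᶜ ∈ 𝓝 r := (hP₀c.union hP₁c).isOpen_compl.mem_nhds
    fun h => h.elim (fun h => (hP₀s h).2 rfl) fun h => (hP₁s h).2 rfl
  have hl'T := hG.eventually_exists_adj hl'r hT
  obtain ⟨Aq, hAq, Ao, hAo, hAqo⟩ := mem_nhds_prod_iff.1 (hG.isOpen_opp.mem_nhds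
    (show (q, o) ∈ {p : V × V | Opp G n p.1 p.2} from hqo))
  obtain ⟨Ac, hAc, Al, hAl, hAcl⟩ := mem_nhds_prod_iff.1 (hG.isOpen_opp.mem_nhds
    (show (c, l) ∈ {p : V × V | Opp G n p.1 p.2} from hcl))
  obtain ⟨B, hB, hBc, hBA⟩ := exists_mem_nhds_isClosed_subset hAc
  -- `W₀` and `W₁` keep images of points near o and p in P₀ and P₁, `W₂` leaves the image of l' a
  -- neighbour outside both, `W₃` and `W₄` keep q and o opposite, `W₅` and `W₆` keep c and l
  -- opposite.
  obtain ⟨W₀, hW₀, h₀⟩ := exists_entourage_of_mem_nhds hP₀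
  obtain ⟨W₁, hW₁, h₁⟩ := exists_entourage_of_mem_nhds hP₁
  obtain ⟨W₂, hW₂, h₂⟩ := exists_entourage_of_mem_nhds hl'T
  obtain ⟨W₃, hW₃, h₃⟩ := exists_entourage_of_mem_nhds hAq
  obtain ⟨W₄, hW₄, h₄⟩ := exists_entourage_of_mem_nhds hAo
  obtain ⟨W₅, hW₅, h₅⟩ := exists_entourage_of_mem_nhds hB
  obtain ⟨W₆, hW₆, h₆⟩ := exists_entourage_of_mem_nhds hAl
  refine ⟨W₀ ∩ (W₁ ∩ (W₂ ∩ (W₃ ∩ (W₄ ∩ (W₅ ∩ W₆))))), by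
    simp only [inter_mem_iff]; exact ⟨hW₀, hW₁, hW₂, hW₃, hW₄, hW₅, hW₆⟩, ?_⟩
  -- When o moves, q, c and l stay fixed. Both l' and p follow continuously, p being the projection
  -- of q to l'.
  have hpq : ∀ᶠ a in 𝓝 l', ∀ b, G.Adj a b → Reach G (n + 1) b q →
      b ∈ {b | ∀ᶠ a in 𝓝 b, ∀ b, (a, b) ∈ W₁ → b ∈ P₁} :=
    hG.eventually_mem_of_proj (hG.opp_near hqo hol').symm hl'p (hpc.concat hqc.symm)
      (eventually_eventually_nhds.2 h₁)
  have hl'o := hG.eventually_mem_of_proj hoc hol' hl'c (hpq.and h₂)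
  filter_upwards [hl'o, h₀, h₄,
    hG.tendsto_opp (x := fun _ => q) (y := id) hqo tendsto_const_nhds tendsto_id]
    with o' ho'l' ho'₀ ho'₄ hqo' hlo' ι U Φ hΦ e he heo'
  by_cases hiso : (𝓝[{y | G.Adj l y ∧ y ≠ o'}] o').NeBot
  · have hY : ((Ultrafilter.of (𝓝[{y | G.Adj l y ∧ y ≠ o'}] o') : Ultrafilter V) : Filter V) ≤
      𝓝[{y | G.Adj l y ∧ y ≠ o'}] o' := Ultrafilter.of_le _
    obtain ⟨W, hWc, hW⟩ := hG.exists_ultrafilter_of_nonisolated hlo' hqo' hqc hcl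
      (hY.trans inf_le_left) (le_principal_iff.1 (hY.trans inf_le_right))
    obtain ⟨m, hom, hmc⟩ := hG.exists_proj (hG.opp_near hcl hlo').symm
    obtain ⟨hm1, hm2⟩ := ho'l' m hom hmc
    obtain ⟨b, hmb, hbc⟩ := hmc
    have hb := hm1 b hmb (hbc.concat hqc.symm)
    obtain ⟨t, ht, hmt⟩ := hm2 _ (hΦ.const m).2.2.1
    refine hG.ulimMap_eq_of_nonisolated (t := t) hlo' hqo' hqc hcl hom ⟨b, hmb, hbc⟩ hmb hbc
      ?_ hBc ?_ ?_ hP₀c hP₁c (Set.disjoint_left.2 fun a ha ha' => (hP₁s ha').1 ha) ?_ ?_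
      (fun h => ht (Or.inl h)) (fun h => ht (Or.inr h)) hmt hWc hW he heo'
    · exact hAqo (Set.mk_mem_prod (h₃.self_of_nhds _ (hΦ.const q).2.2.2.1)
        (ho'₄ _ (hΦ.const o').2.2.2.2.1))
    · exact fun s hs => hAcl (Set.mk_mem_prod (hBA hs)
        (h₆.self_of_nhds _ (hΦ.const l).2.2.2.2.2.2))
    · exact h₅.mono fun c' hc' => hc' _ (hΦ.const c').2.2.2.2.2.1
    · exact fun x hx => ho'₀ _ (hx ▸ (hΦ x).1)
    · exact hb.mono fun a ha x hx => ha _ (hx ▸ (hΦ x).2.1)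
  -- If o' is isolated in D(l), a family in D(l) tending to o' is eventually equal to o'.
  · have h1 : ∀ᶠ y in 𝓝 o', ¬ (G.Adj l y ∧ y ≠ o') := by
      rw [not_neBot, nhdsWithin, inf_principal_eq_bot] at hiso
      exact hiso
    have h2 := (heo' ▸ tendsto_ulim U e).eventually h1
    refine ulim_congr ?_
    filter_upwards [h2, he] with i hi hi'
    rw [not_not.1 fun h => hi ⟨hi', h⟩]

theorem exists_rowEquicontinuous (l : V) :
    ∃ W ∈ 𝓤 V, ∀ o, G.Adj l o → RowEquicontinuous G W l o := by
  have hcpt : IsCompact {o | G.Adj l o} :=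
    (hG.closed_adj.preimage (continuous_const.prodMk continuous_id)).isCompact
  refine hcpt.induction_on (p := fun s => ∃ W ∈ 𝓤 V, ∀ o ∈ s, RowEquicontinuous G W l o)
    ⟨Set.univ, univ_mem, fun _ h => h.elim⟩ ?_ ?_ ?_
  · rintro s t hst ⟨W, hW, h⟩
    exact ⟨W, hW, fun o ho => h o (hst ho)⟩
  · rintro s t ⟨W, hW, h⟩ ⟨W', hW', h'⟩
    exact ⟨W ∩ W', inter_mem hW hW', fun o ho => ho.elim
      (fun ho => (h o ho).mono Set.inter_subset_left)
      fun ho => (h' o ho).mono Set.inter_subset_right⟩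
  · intro o ho
    obtain ⟨W, hW, h⟩ := hG.exists_rowEquicontinuous_near ho
    exact ⟨{o' | G.Adj l o' → RowEquicontinuous G W l o'} ∩ {o' | G.Adj l o'},
      inter_mem (mem_nhdsWithin_of_mem_nhds h) self_mem_nhdsWithin, W, hW, fun o' ho' => ho'.1 ho'.2⟩

/-- Every vertex has, locally uniformly, an opposite vertex `r` such that families of
automorphisms close to the identity are equicontinuous on the neighbours of `r`. -/
theorem exists_entourage_opp : ∃ W ∈ 𝓤 V, ∀ p, ∃ r, Opp G n p r ∧
    (∀ p' r', (p, p') ∈ W → (r, r') ∈ W → Opp G n p' r') ∧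
    ∀ o, G.Adj r o → RowEquicontinuous G W r o := by
  have hind := (isCompact_univ (X := V)).induction_on
    (p := fun s => ∃ W ∈ 𝓤 V, ∀ p ∈ s, ∃ r, Opp G n p r ∧
      (∀ p' r', (p, p') ∈ W → (r, r') ∈ W → Opp G n p' r') ∧
      ∀ o, G.Adj r o → RowEquicontinuous G W r o)
    ⟨Set.univ, univ_mem, fun _ h => h.elim⟩ ?_ ?_ ?_
  · obtain ⟨W, hW, h⟩ := hind
    exact ⟨W, hW, fun p => h p trivial⟩
  · rintro s t hst ⟨W, hW, h⟩
    exact ⟨W, hW, fun o ho => h o (hst ho)⟩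
  · rintro s t ⟨W, hW, h⟩ ⟨W', hW', h'⟩
    refine ⟨W ∩ W', inter_mem hW hW', fun p hp => hp.elim (fun hp => ?_) fun hp => ?_⟩
    · obtain ⟨r, h1, h2, h3⟩ := h p hp
      exact ⟨r, h1, fun p' r' hp' hr' => h2 p' r' hp'.1 hr'.1,
        fun o ho => (h3 o ho).mono Set.inter_subset_left⟩
    · obtain ⟨r, h1, h2, h3⟩ := h' p hp
      exact ⟨r, h1, fun p' r' hp' hr' => h2 p' r' hp'.2 hr'.2,
        fun o ho => (h3 o ho).mono Set.inter_subset_right⟩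
  · intro p _
    obtain ⟨r, hr⟩ := hG.exists_opp p
    have hpr : Opp G n p r := hr
    obtain ⟨Ap, hAp, Ar, hAr, hA⟩ := mem_nhds_prod_iff.1 (hG.isOpen_opp.mem_nhds
      (show (p, r) ∈ {p : V × V | Opp G n p.1 p.2} from hpr))
    obtain ⟨W₁, hW₁, h₁⟩ := exists_entourage_of_mem_nhds hAp
    obtain ⟨W₂, hW₂, h₂⟩ := exists_entourage_of_mem_nhds hAr
    obtain ⟨W₃, hW₃, h₃⟩ := hG.exists_rowEquicontinuous r
    refine ⟨_, mem_nhdsWithin_of_mem_nhds (inter_mem h₁ hAp), W₁ ∩ (W₂ ∩ W₃),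
      inter_mem hW₁ (inter_mem hW₂ hW₃), fun p' hp' => ⟨r, ?_, ?_, ?_⟩⟩
    · exact hA (Set.mk_mem_prod hp'.2 (mem_of_mem_nhds hAr))
    · exact fun p'' r'' hp'' hr'' => hA (Set.mk_mem_prod (hp'.1 _ hp''.1)
        (h₂.self_of_nhds _ hr''.2.1))
    · exact fun o ho => (h₃ o ho).mono fun _ h => h.2.2

/-- Automorphisms sufficiently close to the identity are equicontinuous. -/
theorem exists_entourage_equicontinuous : ∃ W ∈ 𝓤 V, ∀ (ι : Type u) (U : Ultrafilter ι)
    (Φ : ι → (G ≃g G)), IsClose W U Φ →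
    ∀ x : ι → V, ulimMap U Φ x = ulimMap U Φ fun _ => ulim U x := by
  obtain ⟨W, hW, hopp⟩ := hG.exists_entourage_opp
  refine ⟨W, hW, fun ι U Φ hΦ x => ?_⟩
  obtain ⟨i₀⟩ : Nonempty ι := U.nonempty_of_mem univ_mem |>.to_type
  set p₀ := x i₀
  have key : ∀ (k : ℕ) (x : ι → V), (∀ᶠ i in U, Reach G k (x i) p₀) →
      ulimMap U Φ x = ulimMap U Φ fun _ => ulim U x := by
    intro k
    induction k with
    | zero =>
      intro x hx
      have h1 : ulim U x = p₀ := (ulim_congr (y := fun _ => p₀) hx).trans (ulim_const p₀)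
      rw [h1]
      exact ulim_congr (hx.mono fun i hi => by rw [show x i = p₀ from hi])
    | succ k ih =>
      intro x hx
      have hex : ∀ i, ∃ y, Reach G (k + 1) (x i) p₀ → G.Adj (x i) y ∧ Reach G k y p₀ := fun i => by
        by_cases hi : Reach G (k + 1) (x i) p₀
        · obtain ⟨y, hy⟩ := hi
          exact ⟨y, fun _ => hy⟩
        · exact ⟨p₀, fun h => absurd h hi⟩
      choose y hy using hex
      have hxy : ∀ᶠ i in U, G.Adj (y i) (x i) := hx.mono fun i hi => (hy i hi).1.symm
      have hFy := ih y (hx.mono fun i hi => (hy i hi).2)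
      -- Let z be the projection of x to r; then x is the projection of z to y. The limit map is
      -- compatible with y by induction and with z by row equicontinuity at r, hence with x by
      -- uniqueness of projections.
      obtain ⟨r, hr, hr', hrow⟩ := hopp (ulim U y)
      have hex : ∀ i, ∃ z, Opp G n (y i) r ∧ G.Adj (y i) (x i) →
          G.Adj r z ∧ Reach G (n + 1) z (x i) := fun i => by
        by_cases hi : Opp G n (y i) r ∧ G.Adj (y i) (x i)
        · obtain ⟨z, hz⟩ := hG.exists_proj (hG.near_opp hi.1 hi.2).symm
          exact ⟨z, fun _ => hz⟩
        · exact ⟨p₀, fun h => absurd h hi⟩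
      choose z hz using hex
      have hev := (hG.tendsto_opp hr (tendsto_ulim U y) tendsto_const_nhds).and hxy
      have hrz : ∀ᶠ i in U, G.Adj r (z i) := hev.mono fun i hi => (hz i hi).1
      have hzx : ∀ᶠ i in U, Reach G (n + 1) (z i) (x i) := hev.mono fun i hi => (hz i hi).2
      have hrz' := hG.ulim_adj hrz
      rw [ulim_const] at hrz'
      have hFz := hrow _ hrz' ι U Φ hΦ z hrz rfl
      have h1 := hG.ulimMap_adj (Φ := Φ) hxy
      have h2 := hG.ulimMap_reach (Φ := Φ) hzx
      have h3 := hG.ulimConst_adj (U := U) (Φ := Φ) (hG.ulim_adj hxy)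
      have h4 := hG.ulimConst_reach (U := U) (Φ := Φ) (hG.ulim_reach hzx)
      have h5 := hG.ulimConst_adj (U := U) (Φ := Φ) hrz'
      have h6 := hr' _ _ (hΦ.const _) (hΦ.const r)
      rw [hFy] at h1
      rw [hFz] at h2
      exact hG.proj_unique (hG.opp_near h6 h5) h1 h2.symm h3 h4.symm
  rcases U.em fun i => Reach G (n + 3) (x i) p₀ with h | h
  · exact key _ x h
  · exact key _ x (h.mono fun i hi => (hG.diam (x i) p₀).resolve_left hi)

end IsClosedPolygon

/-! ### The action on chambers. -/

section ChamberMap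

variable {V : Type*} {G : SimpleGraph V} {τ : G.Coloring (Fin 2)}

theorem chamMap_inv_apply (φ : G ≃g G) (c : Cham G τ) : chamMap τ φ⁻¹ (chamMap τ φ c) = c := by
  have h := congrFun (chamMap_mul (τ := τ) φ⁻¹ φ) c
  rw [inv_mul_cancel, chamMap_one] at h
  exact h.symm

theorem chamMap_apply_inv (φ : G ≃g G) (c : Cham G τ) : chamMap τ φ (chamMap τ φ⁻¹ c) = c := by
  have h := chamMap_inv_apply φ⁻¹ c
  rwa [inv_inv] at h

theorem apply_eq_or_of_chamMap_eq {φ ψ : G ≃g G} (h : chamMap τ φ = chamMap τ ψ) {v w : V}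
    (hvw : G.Adj v w) : φ v = ψ v ∨ φ v = ψ w := by
  have key : ∀ c : Cham G τ, (φ c.1.1 = ψ c.1.1 ∨ φ c.1.1 = ψ c.1.2) ∧
      (φ c.1.2 = ψ c.1.2 ∨ φ c.1.2 = ψ c.1.1) := fun c => by
    have h' := congrArg Subtype.val (congrFun h c)
    rcases chamMap_spec (τ := τ) φ c with h1 | h1 <;>
    rcases chamMap_spec (τ := τ) ψ c with h2 | h2 <;>
    rw [h1, h2, Prod.mk.injEq] at h' <;> simp [h'.1, h'.2]
  rcases type_cases (τ := τ) hvw with h' | h'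
  · exact (key ⟨(v, w), hvw, h'⟩).1
  · exact (key ⟨(w, v), hvw.symm, h'.2, h'.1⟩).2

/-- The image of v lies in the images of two distinct chambers at v, and these share only one
vertex. -/
theorem chamMap_injective (hthick : IsThick G) :
    Function.Injective (chamMap τ : (G ≃g G) → Cham G τ → Cham G τ) := by
  intro φ ψ h
  ext v
  obtain ⟨a, ha, -⟩ := hthick.exists_adj v v v
  obtain ⟨b, hb, hba, -⟩ := hthick.exists_adj v a a
  rcases apply_eq_or_of_chamMap_eq h ha with h1 | h1
  · exact h1
  · rcases apply_eq_or_of_chamMap_eq h hb with h2 | h2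
    · exact h2
    · exact absurd (ψ.injective (h2.symm.trans h1)) hba

theorem apply_mem_of_chamMap {φ : G ≃g G} {W : Set (V × V)}
    (h : ∀ c : Cham G τ, (c.1.1, (chamMap τ φ c).1.1) ∈ W ∧ (c.1.2, (chamMap τ φ c).1.2) ∈ W)
    {v w : V} (hvw : G.Adj v w) :
    (τ (φ v) = τ v ∧ (v, φ v) ∈ W) ∨ (w, φ v) ∈ W := by
  have key : ∀ c : Cham G τ,
      ((τ (φ c.1.1) = τ c.1.1 ∧ (c.1.1, φ c.1.1) ∈ W) ∨ (c.1.2, φ c.1.1) ∈ W) ∧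
      ((τ (φ c.1.2) = τ c.1.2 ∧ (c.1.2, φ c.1.2) ∈ W) ∨ (c.1.1, φ c.1.2) ∈ W) := fun c => by
    have h' := h c
    have ht := (chamMap τ φ c).2.2
    rcases chamMap_spec (τ := τ) φ c with h1 | h1 <;> rw [h1] at h' ht
    · exact ⟨Or.inl ⟨ht.1.trans c.2.2.1.symm, h'.1⟩, Or.inl ⟨ht.2.trans c.2.2.2.symm, h'.2⟩⟩
    · exact ⟨Or.inr h'.2, Or.inr h'.1⟩
  rcases type_cases (τ := τ) hvw with h' | h'
  · exact (key ⟨(v, w), hvw, h'⟩).1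
  · exact (key ⟨(w, v), hvw.symm, h'.2, h'.1⟩).2

end ChamberMap

/-! ### The topological group structure. -/

section TopologicalGroup

variable {V : Type*} [TopologicalSpace V] [CompactSpace V] [T2Space V] {G : SimpleGraph V}
  {τ : G.Coloring (Fin 2)}

omit [CompactSpace V] [T2Space V] in
theorem isClosed_adj (hclosed : IsClosed (chambers G τ)) :
    IsClosed {p : V × V | G.Adj p.1 p.2} := by
  convert hclosed.union (hclosed.preimage continuous_swap) using 1
  ext ⟨a, b⟩
  refine ⟨fun h => ?_, fun h => ?_⟩
  · rcases type_cases (τ := τ) h with h' | h'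
    · exact Or.inl ⟨h, h'⟩
    · exact Or.inr ⟨SimpleGraph.Adj.symm h, h'.2, h'.1⟩
  · rcases h with h | h
    · exact h.1
    · exact SimpleGraph.Adj.symm h.1

/-- By compactness the images converge to some chamber. Its vertices are the two given limits in
some order, and a chamber is determined by its vertices, so no continuity of `τ` is needed. -/
theorem tendsto_chamMap (hclosed : IsClosed (chambers G τ)) {ι : Type*} {U : Ultrafilter ι}
    {Φ : ι → (G ≃g G)} {x : ι → Cham G τ} {ψ : G ≃g G} {c : Cham G τ}
    (h₁ : Tendsto (fun i => Φ i (x i).1.1) U (𝓝 (ψ c.1.1)))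
    (h₂ : Tendsto (fun i => Φ i (x i).1.2) U (𝓝 (ψ c.1.2))) :
    Tendsto (fun i => chamMap τ (Φ i) (x i)) U (𝓝 (chamMap τ ψ c)) := by
  have : CompactSpace (Cham G τ) := isCompact_iff_compactSpace.1 hclosed.isCompact
  have h := tendsto_ulim U fun i => chamMap τ (Φ i) (x i)
  generalize ulim U (fun i => chamMap τ (Φ i) (x i)) = d at h
  have hd : Tendsto (fun i => (chamMap τ (Φ i) (x i)).1) U (𝓝 d.1) :=
    (continuous_subtype_val.tendsto d).comp h
  suffices hdc : d = chamMap τ ψ c by rwa [← hdc]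
  have hval : d.1 = (ψ c.1.1, ψ c.1.2) ∨ d.1 = (ψ c.1.2, ψ c.1.1) := by
    rcases U.em fun i => (chamMap τ (Φ i) (x i)).1 = (Φ i (x i).1.1, Φ i (x i).1.2) with h' | h'
    · exact Or.inl (tendsto_nhds_unique (hd.congr' h') (h₁.prodMk_nhds h₂))
    · exact Or.inr (tendsto_nhds_unique (hd.congr' (h'.mono fun i hi =>
        (chamMap_spec (Φ i) (x i)).resolve_left hi)) (h₂.prodMk_nhds h₁))
  apply cham_ext
  rcases hval with h1 | h1 <;> rcases chamMap_spec (τ := τ) ψ c with h2 | h2 <;> rw [h1, h2] <;> simp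

theorem continuous_chamMap (hclosed : IsClosed (chambers G τ)) {φ : G ≃g G}
    (hφ : Continuous φ) : Continuous (chamMap τ φ) :=
  continuous_iff_ultrafilter.2 fun c _ hu =>
    tendsto_chamMap (Φ := fun _ => φ) (x := id) hclosed
      (((hφ.comp (continuous_fst.comp continuous_subtype_val)).tendsto c).mono_left hu)
      (((hφ.comp (continuous_snd.comp continuous_subtype_val)).tendsto c).mono_left hu)

theorem mem_autTop (hclosed : IsClosed (chambers G τ)) {φ : G ≃g G} (hφ : Continuous φ)
    (hφ' : Continuous φ.symm) : φ ∈ AutTop G τ := by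
  refine ⟨?_, ?_⟩
  · exact Homeomorph.isHomeomorph
      { toEquiv := φ.toEquiv, continuous_toFun := hφ, continuous_invFun := hφ' }
  · exact Homeomorph.isHomeomorph
      { toFun := chamMap τ φ
        invFun := chamMap τ φ⁻¹
        left_inv := chamMap_inv_apply φ
        right_inv := chamMap_apply_inv φ
        continuous_toFun := continuous_chamMap hclosed hφ
        continuous_invFun := continuous_chamMap hclosed hφ' }

omit [CompactSpace V] [T2Space V] in
theorem continuous_toContinuousMap :
    Continuous (AutTop.toContinuousMap : AutTop G τ → C(Cham G τ, Cham G τ)) :=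
  continuous_induced_dom

theorem autTop_isTopologicalGroup (hclosed : IsClosed (chambers G τ)) :
    IsTopologicalGroup (AutTop G τ) := by
  have : CompactSpace (Cham G τ) := isCompact_iff_compactSpace.1 hclosed.isCompact
  refine { continuous_mul := ?_, continuous_inv := ?_ }
  · refine continuous_induced_rng.2 ?_
    have h : AutTop.toContinuousMap ∘ (fun p : AutTop G τ × AutTop G τ => p.1 * p.2) =
        fun p => (AutTop.toContinuousMap p.1).comp (AutTop.toContinuousMap p.2) := by
      funext p
      exact ContinuousMap.ext fun c => congrFun (chamMap_mul p.1.1 p.2.1) c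
    rw [h]
    exact (continuous_toContinuousMap.comp continuous_fst).compCM
      (continuous_toContinuousMap.comp continuous_snd)
  · refine continuous_induced_rng.2 (ContinuousMap.continuous_compactOpen.2 fun K hK O hO => ?_)
    -- φ⁻¹ maps K into O exactly when φ maps Oᶜ into Kᶜ, and in a compact Hausdorff space this
    -- condition is again subbasic.
    have h : {φ : AutTop G τ | Set.MapsTo ((AutTop.toContinuousMap ∘ fun φ => φ⁻¹) φ) K O} =
        AutTop.toContinuousMap ⁻¹' {f | Set.MapsTo f Oᶜ Kᶜ} := by
      ext φ
      constructor
      · intro h c hc hcK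
        have h' := h hcK
        rw [show ((AutTop.toContinuousMap ∘ fun φ => φ⁻¹) φ) (AutTop.toContinuousMap φ c) = c
          from chamMap_inv_apply φ.1 c] at h'
        exact hc h'
      · intro h c hc
        by_contra hcO
        refine h hcO ?_
        rw [show AutTop.toContinuousMap φ ((AutTop.toContinuousMap ∘ fun φ => φ⁻¹) φ c) = c
          from chamMap_apply_inv φ.1 c]
        exact hc
    rw [h]
    exact (ContinuousMap.isOpen_setOfPred_mapsTo hO.isClosed_compl.isCompact
      hK.isClosed.isOpen_compl).preimage continuous_toContinuousMap

omit [CompactSpace V] in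
theorem autTop_t2Space (hthick : IsThick G) : T2Space (AutTop G τ) := by
  refine T2Space.of_injective_continuous (f := AutTop.toContinuousMap) (fun φ ψ h => ?_)
    continuous_toContinuousMap
  exact Subtype.ext (chamMap_injective (τ := τ) hthick (congrArg DFunLike.coe h))

end TopologicalGroup

/-! ### A compact neighbourhood of the identity. -/

section LocallyCompact

variable {V : Type u} [UniformSpace V] [CompactSpace V] [T2Space V] {G : SimpleGraph V} {n : ℕ}
  {τ : G.Coloring (Fin 2)}

/-- Closeness on chambers yields closeness on vertices as soon as types are preserved; thickness
excludes a type swap near the identity. -/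
theorem setOf_apply_mem_nhds_one (hG : IsGenPolygon G n) (hclosed : IsClosed (chambers G τ))
    {W : Set (V × V)} (hW : W ∈ 𝓤 V) : {φ : AutTop G τ | ∀ v, (v, φ.1 v) ∈ W} ∈ 𝓝 1 := by
  have : CompactSpace (Cham G τ) := isCompact_iff_compactSpace.1 hclosed.isCompact
  cases isEmpty_or_nonempty V with
  | inl hV => exact Filter.mem_of_superset univ_mem fun φ _ v => hV.elim v
  | inr hV =>
    obtain ⟨v₀⟩ := hV
    obtain ⟨a, hva, -⟩ := hG.thick v₀ v₀ v₀
    obtain ⟨b, hvb, hba, -⟩ := hG.thick v₀ a a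
    obtain ⟨W₁, hW₁, hW₁b⟩ := UniformSpace.mem_nhds_iff.1
      (isOpen_compl_singleton.mem_nhds (show a ∈ ({b}ᶜ : Set V) from hba.symm))
    obtain ⟨W₂, hW₂, hsymm, hW₂W⟩ := comp_symm_mem_uniformity_sets hW₁
    have hu : {p : Cham G τ × Cham G τ | (p.1.1.1, p.2.1.1) ∈ W ∩ W₂ ∧
        (p.1.1.2, p.2.1.2) ∈ W ∩ W₂} ∈ 𝓤 (Cham G τ) :=
      inter_mem ((uniformContinuous_fst.comp uniformContinuous_subtype_val) (inter_mem hW hW₂))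
        ((uniformContinuous_snd.comp uniformContinuous_subtype_val) (inter_mem hW hW₂))
    have h := ContinuousMap.tendsto_iff_tendstoUniformly.1
      (continuous_toContinuousMap.tendsto (1 : AutTop G τ)) _ hu
    filter_upwards [h] with φ hφ
    have hφ' : ∀ c : Cham G τ, (c.1.1, (chamMap τ φ.1 c).1.1) ∈ W ∩ W₂ ∧
        (c.1.2, (chamMap τ φ.1 c).1.2) ∈ W ∩ W₂ := fun c => by
      have := hφ c
      rw [show AutTop.toContinuousMap (1 : AutTop G τ) c = c from congrFun chamMap_one c] at this
      exact this
    -- After a swap, the image of v₀ would be `W₂`-close to both a and b, which `W₂` was chosen to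
    -- separate.
    have hv₀ : τ (φ.1 v₀) = τ v₀ := by
      rcases apply_mem_of_chamMap hφ' hva with h1 | h1
      · exact h1.1
      · rcases apply_mem_of_chamMap hφ' hvb with h2 | h2
        · exact h2.1
        · exact absurd rfl (hW₁b (hW₂W ⟨_, h1.2, hsymm.symm _ _ h2.2⟩))
    have hty : ∀ v, τ (φ.1 v) = τ v := fun v => by
      obtain ⟨k, hk⟩ : ∃ k, Reach G k v₀ v := (hG.diam v₀ v).elim (fun h => ⟨_, h⟩) fun h => ⟨_, h⟩
      have h1 := hk.color τ
      have h2 := (hk.map φ.1).color τ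
      rw [hv₀, ← h1] at h2
      have h3 := (τ v).isLt
      have h4 := (τ (φ.1 v)).isLt
      exact Fin.ext (by omega)
    intro v
    obtain ⟨w, hvw, -⟩ := hG.thick v v v
    rcases type_cases (τ := τ) hvw with h' | h'
    · have h1 := hφ' ⟨(v, w), hvw, h'⟩
      have h2 := (chamMap τ φ.1 ⟨(v, w), hvw, h'⟩).2.2
      rcases chamMap_spec (τ := τ) φ.1 ⟨(v, w), hvw, h'⟩ with h3 | h3 <;> rw [h3] at h1 h2
      · exact h1.1.1
      · exact absurd ((hty v).symm.trans h2.2) (by rw [h'.1]; decide)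
    · have h1 := hφ' ⟨(w, v), hvw.symm, h'.2, h'.1⟩
      have h2 := (chamMap τ φ.1 ⟨(w, v), hvw.symm, h'.2, h'.1⟩).2.2
      rcases chamMap_spec (τ := τ) φ.1 ⟨(w, v), hvw.symm, h'.2, h'.1⟩ with h3 | h3 <;>
        rw [h3] at h1 h2
      · exact h1.2.1
      · exact absurd ((hty v).symm.trans h2.1) (by rw [h'.1]; decide)

omit [T2Space V] in
theorem isClose_of_eventually {ι : Type*} {U : Ultrafilter ι} {Φ : ι → (G ≃g G)}
    {W : Set (V × V)} (hWc : IsClosed W) (h : ∀ᶠ i in U, ∀ v, (v, Φ i v) ∈ W) : IsClose W U Φ :=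
  fun x => hWc.mem_of_tendsto ((tendsto_ulim U x).prodMk_nhds (tendsto_ulim U _))
    (h.mono fun _ hi => hi _)

/-- The iterated limit, over v → p and then along U, is a single limit along an ultrafilter on ι ×
V, to which the equicontinuity hypothesis applies. -/
theorem continuous_ulimConst {ι : Type u} {U : Ultrafilter ι} {Φ : ι → (G ≃g G)}
    {W : Set (V × V)} (hWc : IsClosed W)
    (hW : ∀ (ι : Type u) (U : Ultrafilter ι) (Φ : ι → (G ≃g G)), IsClose W U Φ →
      ∀ x : ι → V, ulimMap U Φ x = ulimMap U Φ fun _ => ulim U x)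
    (h : ∀ᶠ i in U, ∀ v, (v, Φ i v) ∈ W) : Continuous fun v => ulimMap U Φ fun _ => v := by
  refine continuous_iff_ultrafilter.2 fun p Y hY => ?_
  let U' : Ultrafilter (ι × V) := Y.bind fun v => U.map fun i => (i, v)
  have hU' : ∀ {P : ι × V → Prop}, (∀ᶠ r in U', P r) ↔ ∀ᶠ v in Y, ∀ᶠ i in U, P (i, v) := Iff.rfl
  have h1 := hW _ U' (fun r => Φ r.1)
    (isClose_of_eventually hWc (hU'.2 (.of_forall fun v => h))) Prod.snd
  have h2 : ulim U' Prod.snd = p := ulim_eq fun s hs =>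
    hU'.2 (Eventually.mono (show ∀ᶠ v in (Y : Filter V), v ∈ s from hY hs)
      fun v hv => .of_forall fun _ => hv)
  have h3 : ulimMap U' (fun r => Φ r.1) (fun _ => p) = ulimMap U Φ fun _ => p :=
    ulim_eq fun s hs => hU'.2 (.of_forall fun v => tendsto_ulim U (fun i => Φ i p) hs)
  rw [h2, h3] at h1
  refine (closed_nhds_basis _).tendsto_right_iff.2 fun C hC => ?_
  have h4 : ∀ᶠ r : ι × V in (U' : Filter (ι × V)), Φ r.1 r.2 ∈ C := by
    have := tendsto_ulim U' fun r : ι × V => Φ r.1 r.2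
    rw [show ulim U' (fun r : ι × V => Φ r.1 r.2) = _ from h1] at this
    exact this hC.1
  exact (hU'.1 h4).mono fun v hv => ulim_mem hC.2 hv

theorem isCompact_setOf_apply_mem (hG : IsClosedPolygon G n) (hclosed : IsClosed (chambers G τ))
    {W : Set (V × V)} (hWc : IsClosed W) (hWs : ∀ a b, (a, b) ∈ W → (b, a) ∈ W)
    (hW : ∀ (ι : Type u) (U : Ultrafilter ι) (Φ : ι → (G ≃g G)), IsClose W U Φ →
      ∀ x : ι → V, ulimMap U Φ x = ulimMap U Φ fun _ => ulim U x) :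
    IsCompact {φ : AutTop G τ | ∀ v, (v, φ.1 v) ∈ W} := by
  have : CompactSpace (Cham G τ) := isCompact_iff_compactSpace.1 hclosed.isCompact
  refine isCompact_iff_ultrafilter_le_nhds.2 fun U hU => ?_
  have hN : ∀ᶠ φ : AutTop G τ in (U : Filter _), ∀ v, (v, φ.1 v) ∈ W := le_principal_iff.1 hU
  have hN' : ∀ᶠ φ : AutTop G τ in (U : Filter _), ∀ v, (v, φ.1.symm v) ∈ W := hN.mono fun φ h v => by
    have := hWs _ _ (h (φ.1.symm v))
    rwa [φ.1.apply_symm_apply] at this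
  have hc := isClose_of_eventually (Φ := fun φ : AutTop G τ => φ.1) hWc hN
  have hc' := isClose_of_eventually (Φ := fun φ : AutTop G τ => φ.1.symm) hWc hN'
  let F : V → V := fun v => ulimMap U (fun φ : AutTop G τ => φ.1) fun _ => v
  let F' : V → V := fun v => ulimMap U (fun φ : AutTop G τ => φ.1.symm) fun _ => v
  have hF : ∀ x, ulimMap U (fun φ : AutTop G τ => φ.1) x = F (ulim U x) := hW _ U _ hc
  have hF' : ∀ x, ulimMap U (fun φ : AutTop G τ => φ.1.symm) x = F' (ulim U x) := hW _ U _ hc'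
  -- Equicontinuity allows evaluation at moving points: F (F' v) is the limit of φ (φ⁻¹ v) = v.
  have hFF' : ∀ v, F (F' v) = v := fun v => by
    refine (hF fun φ => φ.1.symm v).symm.trans ?_
    simp only [ulimMap, RelIso.apply_symm_apply]
    exact ulim_const v
  have hF'F : ∀ v, F' (F v) = v := fun v => by
    refine (hF' fun φ => φ.1 v).symm.trans ?_
    simp only [ulimMap, RelIso.symm_apply_apply]
    exact ulim_const v
  let ψ : G ≃g G :=
    { toFun := F
      invFun := F'
      left_inv := hF'F
      right_inv := hFF'
      map_rel_iff' := fun {a b} => by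
        refine ⟨fun h => ?_, fun h => hG.ulimConst_adj h⟩
        have := hG.ulimConst_adj (U := U) (Φ := fun φ : AutTop G τ => φ.1.symm) h
        change G.Adj (F' (F a)) (F' (F b)) at this
        rwa [hF'F, hF'F] at this }
  have hψ : ψ ∈ AutTop G τ := mem_autTop hclosed (continuous_ulimConst hWc hW hN)
    (continuous_ulimConst hWc hW hN')
  refine ⟨⟨ψ, hψ⟩, fun v => hc.const v, ?_⟩
  rw [nhds_induced, ← tendsto_iff_comap]
  refine ContinuousMap.tendsto_nhds_compactOpen.2 fun K hK O hO hKO => ?_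
  -- Otherwise there are chambers x φ in K sent outside O; they accumulate at a chamber of K, which
  -- ψ sends into O, contrary to convergence along moving points.
  by_contra hcon
  have hcon := Ultrafilter.eventually_not.2 hcon
  have hex : ∀ φ : AutTop G τ, ¬ Set.MapsTo (AutTop.toContinuousMap φ) K O →
      ∃ c ∈ K, chamMap τ φ.1 c ∉ O := fun φ h => by
    simp only [Set.MapsTo] at h
    push Not at h
    exact h
  obtain ⟨φ₀, hφ₀⟩ := hcon.exists
  obtain ⟨c₀, -⟩ := hex φ₀ hφ₀
  have hex' : ∀ φ : AutTop G τ, ∃ c, ¬ Set.MapsTo (AutTop.toContinuousMap φ) K O →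
      c ∈ K ∧ chamMap τ φ.1 c ∉ O := fun φ => by
    by_cases h : Set.MapsTo (AutTop.toContinuousMap φ) K O
    · exact ⟨c₀, fun h' => absurd h h'⟩
    · exact (hex φ h).imp fun c hc _ => hc
  choose x hx using hex'
  have hxK : ulim U x ∈ K := ulim_mem hK.isClosed (hcon.mono fun φ h => (hx φ h).1)
  have hval : ∀ f : Cham G τ → V, Continuous f →
      Tendsto (fun φ : AutTop G τ => φ.1 (f (x φ))) U (𝓝 (F (f (ulim U x)))) := fun f hf => by
    have h1 := tendsto_ulim U fun φ : AutTop G τ => φ.1 (f (x φ))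
    rwa [show ulim U (fun φ : AutTop G τ => φ.1 (f (x φ))) = _ from hF fun φ => f (x φ),
      show ulim U (fun φ => f (x φ)) = f (ulim U x) from
        ulim_eq ((hf.tendsto _).comp (tendsto_ulim U x))] at h1
  have hlim := tendsto_chamMap (τ := τ) (ψ := ψ) (Φ := fun φ : AutTop G τ => φ.1) hclosed
    (hval (fun c => c.1.1) (continuous_fst.comp continuous_subtype_val))
    (hval (fun c => c.1.2) (continuous_snd.comp continuous_subtype_val))
  obtain ⟨φ, h1, h2⟩ := ((hlim.eventually (hO.mem_nhds (hKO hxK))).and hcon).exists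
  exact (hx φ h2).2 h1

theorem autTop_locallyCompactSpace (hG : IsClosedPolygon G n) (hclosed : IsClosed (chambers G τ)) :
    LocallyCompactSpace (AutTop G τ) := by
  obtain ⟨W, hW, hWeq⟩ := hG.exists_entourage_equicontinuous
  obtain ⟨W', ⟨hW', hW'c⟩, hW'W⟩ := uniformity_hasBasis_closed.mem_iff.1 hW
  have := autTop_isTopologicalGroup hclosed
  -- The entourage is symmetrised so that inverses are controlled as well.
  refine (isCompact_setOf_apply_mem (τ := τ) (W := W' ∩ Prod.swap ⁻¹' W') hG hclosed
    (hW'c.inter (hW'c.preimage continuous_swap)) (fun a b h => ⟨h.2, h.1⟩)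
    fun ι U Φ h => hWeq ι U Φ (h.mono (Set.inter_subset_left.trans hW'W)))
    |>.locallyCompactSpace_of_mem_nhds_of_group
    (setOf_apply_mem_nhds_one hG.toIsGenPolygon hclosed (inter_mem hW' (symm_le_uniformity hW')))

end LocallyCompact

end CompactPolygon

theorem mainTheorem5 {V : Type*} [TopologicalSpace V] [CompactSpace V] [T2Space V]
    (m : ℕ) (hm : 3 ≤ m) (G : SimpleGraph V) (τ : G.Coloring (Fin 2))
    (hpolygon : CompactPolygon.IsPolygon G m) (hthick : CompactPolygon.IsThick G)
    (hclosed : IsClosed (CompactPolygon.chambers G τ)) :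
    IsTopologicalGroup (CompactPolygon.AutTop G τ) ∧
      T2Space (CompactPolygon.AutTop G τ) ∧
      LocallyCompactSpace (CompactPolygon.AutTop G τ) := by
  obtain ⟨n, rfl⟩ := Nat.exists_eq_add_of_le' hm
  refine ⟨CompactPolygon.autTop_isTopologicalGroup hclosed,
    CompactPolygon.autTop_t2Space hthick, ?_⟩
  let _ : UniformSpace V := uniformSpaceOfCompactR1
  exact CompactPolygon.autTop_locallyCompactSpace
    ⟨hpolygon.isGenPolygon τ hthick, CompactPolygon.isClosed_adj hclosed⟩ hclosed
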